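/- Let $p\ge 2$ and let $\tau:\{0,1\}\to\{0,1\}^p$ be a substitution of constant length $p$ that is one-to-one ($\tau(0)\neq\tau(1)$) and primitive (for some $n$ both letters occur in $\tau^n(0)$ and in $\tau^n(1)$). Let $X_\tau\subseteq\{0,1\}^{\mathbb Z}$ be the subshift of all sequences each of whose finite words occurs in some $\tau^n(a)$, with the shift $T$, $(Tx)_n=x_{n+1}$, and assume that $X_\tau$ is infinite. Let $\varrho$ be any metric on $X_\tau$ inducing its topology. A pair $(x,y)\in X_\tau^2$ is *distal* if $\liminf_n\varrho(T^nx,T^ny)>0$, *asymptotic* if $\lim_n\varrho(T^nx,T^ny)=0$, and a *Li–Yorke pair* if $\liminf_n\varrho(T^nx,T^ny)=0<\limsup_n\varrho(T^nx,T^ny)$. Extend $\tau$ to two-sided sequences by $\tau(x)=\dots\tau(x_{-1}).\tau(x_0)\tau(x_1)\dots$. For $x\in X_\tau$ let $(x^{(i)})_{i\ge0}$ in $X_\tau$ and $\pi(x)=(\delta_i)_{i\ge0}$ in $\{0,\dots,p-1\}$ be the unique sequences with $x^{(0)}=x$ and $\tau(x^{(i+1)})=T^{-\delta_i}x^{(i)}$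 for all $i\ge 0$ (they exist by Mossé's theorem). Put $s_i(x)=x^{(i)}_1\cdots x^{(i)}_{p-1-\delta_i}$ (the empty word if $\delta_i=p-1$) and $\mathcal I^+(x)=\{i\ge0: s_i(x)\text{ is not empty}\}$. If $\mathcal I^+(x)$ is finite, put $k^+(x)=\max\{|x_0s_0(x)\tau(s_1(x))\cdots\tau^i(s_i(x))|: i\in\mathcal I^+(x)\}$, with $k^+(x)=|x_0|=1$ if $\mathcal I^+(x)=\emptyset$. A position $i\in\{0,\dots,p-1\}$ is a *coincidence* if $\tau(0)_i=\tau(1)_i$ and a *non-coincidence* otherwise. Then: 1. Suppose that there is no coincidence, and let $x,y\in X_\tau$ with $\pi(x)=\pi(y)$. If there is $i\ge0$ such that $x_i\ne y_i$ and $\mathcal I^+(T^ix)$, $\mathcal I^+(T^iy)$ are infinite, then $(x,y)$ is distal. In any other case $(x,y)$ is asymptotic. 2. If there is a unique non-coincidence, then all $x,y\in X_\tau$ with $\pi(x)=\pi(y)$ form an asymptotic pair. 3. There exist Li–Yorke pairs in $X_\tau$ if and only if there exist a coincidence and at least two non-coincidences. Moreover, suppose that there is a coincidence, and let $x,y\in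 X_\tau$ with $\pi(x)=\pi(y)$. If $\mathcal I^+(x)$ is infinite, then $(x,y)$ is a Li–Yorke pair if and only if $s_i(x)\ne s_i(y)$ for infinitely many $i$. If $\mathcal I^+(x)$ is finite, then $(x,y)$ is a Li–Yorke pair if and only if $s_i(T^{k^+(x)}x)\ne s_i(T^{k^+(y)}y)$ for infinitely many $i$. -/

import Mathlib

open Filter Topology

namespace ConstLengthSubst

/-! ### Pairs of points of a dynamical system `(X, T)` with metric `dist`

These are used on a compact space only, so all the sequences involved are bounded. -/

section Pairs

variable {X : Type*} [MetricSpace X]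

/-- Distal pair: `liminf ϱ(Tⁿx, Tⁿy) > 0`. -/
def IsDistalPair (T : X → X) (x y : X) : Prop :=
  0 < liminf (fun n : ℕ => dist (T^[n] x) (T^[n] y)) atTop

/-- Asymptotic pair: `lim ϱ(Tⁿx, Tⁿy) = 0`. -/
def IsAsymptoticPair (T : X → X) (x y : X) : Prop :=
  Tendsto (fun n : ℕ => dist (T^[n] x) (T^[n] y)) atTop (𝓝 0)

/-- Li–Yorke pair: `limsup ϱ(Tⁿx, Tⁿy) > 0` and `liminf ϱ(Tⁿx, Tⁿy) = 0`. -/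
def IsLiYorkePair (T : X → X) (x y : X) : Prop :=
  0 < limsup (fun n : ℕ => dist (T^[n] x) (T^[n] y)) atTop ∧
    liminf (fun n : ℕ => dist (T^[n] x) (T^[n] y)) atTop = 0

end Pairs

/-! ### Substitutions of constant length

A substitution of constant length `p` on the alphabet `A` is a map `τ : A → Fin p → A`:
the word `τ(a)` has the letters `τ a 0, …, τ a (p - 1)`. -/

section Substitution

variable {A : Type*} {p : ℕ}

/-- The extension of `τ` to finite words by concatenation. -/
def onWord (τ : A → Fin p → A) (w : List A) : List A :=
  w.flatMap fun a => List.ofFn (τ a)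

/-- The word `τⁿ(a)`. -/
def iterWord (τ : A → Fin p → A) (n : ℕ) (a : A) : List A :=
  (onWord τ)^[n] [a]

/-- The extension of `τ` to two-sided sequences: `τ(x) = … τ(x₋₁) . τ(x₀) τ(x₁) …`, where
`τ(x₀)` starts at the coordinate `0` (`/` and `%` on `ℤ` round down for a positive divisor). -/
def onSeq [NeZero p] (τ : A → Fin p → A) (x : ℤ → A) : ℤ → A := fun n =>
  τ (x (n / (p : ℤ))) ⟨(n % (p : ℤ)).toNat, by
    have hp : (0 : ℤ) < p := by exact_mod_cast Nat.pos_of_ne_zero (NeZero.ne p)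
    have h1 := Int.emod_nonneg n hp.ne'
    have h2 := Int.emod_lt_of_pos n hp
    omega⟩

/-- `τ` is primitive: for some `n`, every letter appears in `τⁿ(b)` for every letter `b`. -/
def IsPrimitive (τ : A → Fin p → A) : Prop :=
  ∃ n : ℕ, ∀ a b : A, a ∈ iterWord τ n b

/-- `τ` has a coincidence: `τ(a)` and `τ(b)` have the same letter at some position, for some
letters `a ≠ b`. -/
def HasCoincidence (τ : A → Fin p → A) : Prop :=
  ∃ a b : A, a ≠ b ∧ ∃ i : Fin p, τ a i = τ b i

/-- The word of length `n` of the sequence `x` that starts at the coordinate `i`. -/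
def wordAt (x : ℤ → A) (i : ℤ) (n : ℕ) : List A :=
  (List.range n).map fun j : ℕ => x (i + (j : ℤ))

/-- The subshift `X_τ`: the two-sided sequences all of whose finite words occur in some
`τᵏ(a)`. -/
def subshift (τ : A → Fin p → A) : Set (ℤ → A) :=
  {x | ∀ (i : ℤ) (n : ℕ), ∃ (k : ℕ) (a : A), wordAt x i n <:+: iterWord τ k a}

theorem shift_mem_subshift (τ : A → Fin p → A) {x : ℤ → A} (hx : x ∈ subshift τ) :
    (fun n : ℤ => x (n + 1)) ∈ subshift τ := by
  intro i n
  obtain ⟨k, a, h⟩ := hx (i + 1) n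
  refine ⟨k, a, ?_⟩
  have e : wordAt (fun n : ℤ => x (n + 1)) i n = wordAt x (i + 1) n := by
    unfold wordAt
    refine List.map_congr_left fun j _ => ?_
    change x (i + (j : ℤ) + 1) = x (i + 1 + (j : ℤ))
    congr 1
    ring
  rw [e]
  exact h

/-- The shift `T` on `X_τ`: `(T x)ₙ = xₙ₊₁`. -/
def shift (τ : A → Fin p → A) (x : subshift τ) : subshift τ :=
  ⟨fun n : ℤ => x.1 (n + 1), shift_mem_subshift τ x.2⟩

end Substitution

/-! ### The factor map onto the odometer and the words `s_i(x)` -/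

section Odometer

variable {A : Type*} [Nonempty A] {p : ℕ} [NeZero p]

/-- The points `x⁽ⁱ⁾ = xs i` of `X_τ` and the digits `δ_i = δ i` in `{0, …, p - 1}` satisfy
`x⁽⁰⁾ = x` and `τ(x⁽ⁱ⁺¹⁾) = T^{-δ_i}(x⁽ⁱ⁾)`. -/
def IsDesubstitution (τ : A → Fin p → A) (x : ℤ → A) (xs : ℕ → ℤ → A) (δ : ℕ → Fin p) : Prop :=
  xs 0 = x ∧ (∀ i, xs i ∈ subshift τ) ∧
    ∀ i, onSeq τ (xs (i + 1)) = fun n : ℤ => xs i (n - ((δ i : ℕ) : ℤ))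

/-- The pair of sequences `(x⁽ⁱ⁾)`, `(δ_i)` attached to `x`. For a primitive `τ` with `X_τ`
infinite and `x ∈ X_τ`, exactly one pair with `IsDesubstitution` exists, by the recognizability
theorem of Mossé; `Classical.epsilon` selects it. -/
noncomputable def desubst (τ : A → Fin p → A) (x : ℤ → A) : (ℕ → ℤ → A) × (ℕ → Fin p) :=
  Classical.epsilon fun q => IsDesubstitution τ x q.1 q.2

/-- The point `x⁽ⁱ⁾`. -/
noncomputable def level (τ : A → Fin p → A) (x : ℤ → A) (i : ℕ) : ℤ → A :=
  (desubst τ x).1 i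

/-- The factor map `π` onto the `p`-odometer, whose points are written as digit sequences in
base `p`: `π(x) = (δ_i)_i`. -/
noncomputable def toOdometer (τ : A → Fin p → A) (x : ℤ → A) : ℕ → Fin p :=
  (desubst τ x).2

/-- The word `s_i(x) = x⁽ⁱ⁾(1, p - 1 - δ_i)`, empty if `δ_i = p - 1`. -/
noncomputable def sWord (τ : A → Fin p → A) (x : ℤ → A) (i : ℕ) : List A :=
  wordAt (level τ x i) 1 (p - 1 - (toOdometer τ x i : ℕ))

/-- `I⁺(x)`, the set of all `i` for which `s_i(x)` is not empty. -/
def iPlus (τ : A → Fin p → A) (x : ℤ → A) : Set ℕ :=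
  {i | (sWord τ x i).length ≠ 0}

/-- The word `x₀ s₀(x) τ(s₁(x)) ⋯ τⁱ(s_i(x))`. -/
noncomputable def rightWord (τ : A → Fin p → A) (x : ℤ → A) (i : ℕ) : List A :=
  x 0 :: (List.range (i + 1)).flatMap fun j => (onWord τ)^[j] (sWord τ x j)

/-- `k⁺(x)`, used only when `I⁺(x)` is finite: the maximum of the lengths of the words
`x₀ s₀(x) τ(s₁(x)) ⋯ τⁱ(s_i(x))` over `i ∈ I⁺(x)`, and the length `1` of the word `x₀` alone
when `I⁺(x)` is empty. -/
noncomputable def kPlus (τ : A → Fin p → A) (x : ℤ → A) : ℕ :=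
  max 1 (sSup ((fun i => (rightWord τ x i).length) '' iPlus τ x))

end Odometer

end ConstLengthSubst

open ConstLengthSubst

/-!
If `τ(u) = Tʲ τ(v)` with `u, v ∈ X_τ` and `0 < j < p`, then by minimality `T^(jⁿ)` preserves
`τⁿ(X_τ)` for all `n`, and conjugating it by `τⁿ` gives a block code on `X_τ` that reads two
letters because `jⁿ ≤ pⁿ`. There are finitely many such codes; the same code at two different
levels makes every point of `X_τ` periodic with the same period, so that `X_τ` is finite. Hence the
digits of `x` and the points `x⁽ⁱ⁾` exist and are unique.

If infinitely many `s_i(x)` are nonempty, the right half of `x` is `x₀ s₀(x) τ(s₁(x)) τ²(s₂(x)) ⋯`,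
so `x` and a point `y` with the same digits differ at arbitrarily large coordinates if and only if
`s_i(x) ≠ s_i(y)` for infinitely many `i`. If `I⁺(x)` is finite, adding `k⁺(x)` to the digits gives
`(0, 0, …)`, and the criterion applies to `T^{k⁺(x)} x`.

By compactness, the type of a pair depends only on where the sequences agree: on arbitrarily long
windows far to the right (proximality), or at all large coordinates. A coincidence makes
`x⁽ⁱ⁾` and `y⁽ⁱ⁾` agree at a bounded coordinate, hence `x` and `y` on a block of length `pⁱ`, so
points with the same digits are proximal; conversely recognizability forces proximal points to have
the same digits. Without coincidences every column of every `τⁱ` is injective, so whether `x` and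
`y` agree at one coordinate decides whether they agree at all later ones. For a single
non-coincidence `r₀`, the letters of `τⁱ(a)` and `τⁱ(b)` differ at most at the one position with all
digits `r₀`. For two non-coincidences `r < s`, points with all digits equal to `r` and with
`x⁽ⁱ⁾₀ ≠ y⁽ⁱ⁾₀` for all `i` satisfy `s_i(x) ≠ s_i(y)` for all `i`, because the column `s` is
read inside `s_i`.
-/

namespace ConstLengthSubst

/-! ### Sequences and words -/

section Sequences

variable {A : Type*} {p : ℕ}

/-- The sequence `Tᵏ x`, for an integer `k`. -/
def shiftBy (k : ℤ) (x : ℤ → A) : ℤ → A := fun n => x (n + k)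

@[simp] theorem shiftBy_apply (k : ℤ) (x : ℤ → A) (n : ℤ) : shiftBy k x n = x (n + k) := rfl

@[simp] theorem shiftBy_zero (x : ℤ → A) : shiftBy 0 x = x := by
  funext n; simp

@[simp] theorem shiftBy_shiftBy (k l : ℤ) (x : ℤ → A) :
    shiftBy k (shiftBy l x) = shiftBy (k + l) x := by
  funext n; simp [add_assoc]

theorem shiftBy_injective (k : ℤ) : Function.Injective (shiftBy k : (ℤ → A) → ℤ → A) :=
  Function.LeftInverse.injective (g := shiftBy (-k)) fun x => by simp

variable [NeZero p] (τ : A → Fin p → A)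

theorem natCast_pos_of_neZero : (0 : ℤ) < p := by
  exact_mod_cast Nat.pos_of_neZero p

theorem onSeq_apply (x : ℤ → A) (q : ℤ) (r : Fin p) :
    onSeq τ x (p * q + (r : ℕ)) = τ (x q) r := by
  have hr : ((r : ℕ) : ℤ) < p := by exact_mod_cast r.2
  obtain ⟨hdiv, hmod⟩ := (Int.ediv_emod_unique (natCast_pos_of_neZero (p := p))).2
    ⟨add_comm ((r : ℕ) : ℤ) (p * q), Int.natCast_nonneg r, hr⟩
  simp only [onSeq, hdiv, hmod, Int.toNat_natCast]

theorem exists_eq_mul_add (n : ℤ) : ∃ (q : ℤ) (r : Fin p), n = p * q + (r : ℕ) := by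
  have hp := natCast_pos_of_neZero (p := p)
  have hnonneg := Int.emod_nonneg n hp.ne'
  have hlt := Int.emod_lt_of_pos n hp
  refine ⟨n / p, ⟨(n % p).toNat, by omega⟩, ?_⟩
  rw [Int.toNat_of_nonneg hnonneg, Int.mul_ediv_add_emod]

theorem onSeq_shiftBy (q : ℤ) (x : ℤ → A) :
    onSeq τ (shiftBy q x) = shiftBy (p * q) (onSeq τ x) := by
  funext n
  obtain ⟨m, r, rfl⟩ := exists_eq_mul_add (p := p) n
  rw [onSeq_apply, shiftBy_apply, shiftBy_apply, add_right_comm, ← mul_add, onSeq_apply]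

theorem iterate_onSeq_shiftBy (k : ℕ) (q : ℤ) (x : ℤ → A) :
    (onSeq τ)^[k] (shiftBy q x) = shiftBy (p ^ k * q) ((onSeq τ)^[k] x) := by
  induction k with
  | zero => simp
  | succ k ih =>
    rw [Function.iterate_succ_apply', ih, onSeq_shiftBy, Function.iterate_succ_apply', pow_succ',
      mul_assoc]

variable {τ} in
theorem onSeq_injective (hinj : Function.Injective τ) : Function.Injective (onSeq τ) := by
  intro x y h
  funext q
  apply hinj
  funext r
  rw [← onSeq_apply τ x, ← onSeq_apply τ y, h]

/-- The letters of the word `τᵏ(a)` at the coordinates `0, …, pᵏ - 1`, repeated with period `pᵏ`.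
As a function on `ℤ` it needs no bounds on its index. -/
def iterLetter (k : ℕ) (a : A) : ℤ → A := (onSeq τ)^[k] fun _ => a

theorem iterate_onSeq_apply (k : ℕ) (x : ℤ → A) (n : ℤ) :
    (onSeq τ)^[k] x n = iterLetter τ k (x (n / (p : ℤ) ^ k)) n := by
  induction k generalizing n with
  | zero => simp [iterLetter]
  | succ k ih =>
    obtain ⟨q, r, rfl⟩ := exists_eq_mul_add (p := p) n
    have hquot : ((p : ℤ) * q + (r : ℕ)) / (p : ℤ) ^ (k + 1) = q / (p : ℤ) ^ k := by
      have hp := natCast_pos_of_neZero (p := p)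
      have hr : ((r : ℕ) : ℤ) < p := by exact_mod_cast r.2
      rw [pow_succ', ← Int.ediv_ediv_of_nonneg hp.le, Int.mul_add_ediv_left _ _ hp.ne',
        Int.ediv_eq_zero_of_lt (Int.natCast_nonneg _) hr, add_zero]
    rw [hquot, iterLetter, Function.iterate_succ_apply', Function.iterate_succ_apply', onSeq_apply,
      onSeq_apply, ih, iterLetter]

theorem iterLetter_succ_apply (k : ℕ) (a : A) (q : ℤ) (r : Fin p) :
    iterLetter τ (k + 1) a (p * q + (r : ℕ)) = τ (iterLetter τ k a q) r := by
  rw [iterLetter, Function.iterate_succ_apply', onSeq_apply, iterLetter]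

end Sequences

section Words

variable {A : Type*} {p : ℕ}

@[simp] theorem length_wordAt (x : ℤ → A) (i : ℤ) (n : ℕ) : (wordAt x i n).length = n := by
  simp [wordAt]

@[simp] theorem getElem_wordAt (x : ℤ → A) (i : ℤ) (n j : ℕ) (hj : j < (wordAt x i n).length) :
    (wordAt x i n)[j] = x (i + j) := by
  simp [wordAt]

theorem wordAt_eq_iff {x y : ℤ → A} {i j : ℤ} {n : ℕ} :
    wordAt x i n = wordAt y j n ↔ ∀ k : ℕ, k < n → x (i + k) = y (j + k) := by
  simp [wordAt]

theorem wordAt_shiftBy (k : ℤ) (x : ℤ → A) (i : ℤ) (n : ℕ) :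
    wordAt (shiftBy k x) i n = wordAt x (i + k) n :=
  wordAt_eq_iff.2 fun j _ => congrArg x (by ring)

theorem wordAt_add (x : ℤ → A) (i : ℤ) (m n : ℕ) :
    wordAt x i (m + n) = wordAt x i m ++ wordAt x (i + m) n := by
  simp [wordAt, List.range_add, Function.comp_def, add_assoc]

theorem infix_wordAt_iff {w : List A} {y : ℤ → A} {i : ℤ} {L : ℕ} :
    w <:+: wordAt y i L ↔ ∃ m : ℕ, m + w.length ≤ L ∧ wordAt y (i + m) w.length = w := by
  constructor
  · rintro ⟨s, t, h⟩
    have hL : s.length + w.length + t.length = L := by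
      simpa [add_assoc] using congrArg List.length h
    rw [← hL, wordAt_add, wordAt_add] at h
    have hsw := List.append_inj_left h (by simp)
    exact ⟨s.length, by omega, (List.append_inj_right hsw (by simp)).symm⟩
  · rintro ⟨m, hm, hw⟩
    obtain ⟨r, rfl⟩ := Nat.exists_eq_add_of_le hm
    exact ⟨wordAt y i m, wordAt y (i + (m + w.length : ℕ)) r, by rw [wordAt_add, wordAt_add, hw]⟩

theorem wordAt_infix_wordAt (x : ℤ → A) {i j : ℤ} {m n : ℕ} (hij : i ≤ j) (hjm : j + n ≤ i + m) :
    wordAt x j n <:+: wordAt x i m := by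
  obtain ⟨d, rfl⟩ := Int.le.dest hij
  exact infix_wordAt_iff.2 ⟨d, by rw [length_wordAt]; omega, by rw [length_wordAt]⟩

theorem wordAt_add_eq_of_wordAt_eq {x y : ℤ → A} {i j : ℤ} {m : ℕ}
    (h : wordAt x i m = wordAt y j m) {e n : ℕ} (hm : e + n ≤ m) :
    wordAt x (i + e) n = wordAt y (j + e) n :=
  wordAt_eq_iff.2 fun k hk => by
    have := wordAt_eq_iff.1 h (e + k) (by omega)
    push_cast at this
    simpa only [add_assoc] using this

theorem eqOn_Ico_of_wordAt_eq {x y : ℤ → A} {i j : ℤ} {n : ℕ} (h : wordAt x i n = wordAt y j n) :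
    Set.EqOn x (shiftBy (j - i) y) (Set.Ico i (i + n)) := by
  rintro l ⟨hil, hln⟩
  obtain ⟨k, rfl⟩ := Int.le.dest hil
  rw [wordAt_eq_iff.1 h k (by omega), shiftBy_apply]
  exact congrArg y (by ring)

variable (τ : A → Fin p → A)

theorem onWord_append (v w : List A) : onWord τ (v ++ w) = onWord τ v ++ onWord τ w :=
  List.flatMap_append

theorem iterate_onWord_infix {v w : List A} (h : v <:+: w) (k : ℕ) :
    (onWord τ)^[k] v <:+: (onWord τ)^[k] w := by
  induction k with
  | zero => exact h
  | succ k ih =>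
    simp only [Function.iterate_succ_apply']
    exact ih.flatMap _

theorem iterWord_add (k l : ℕ) (a : A) : iterWord τ (k + l) a = (onWord τ)^[k] (iterWord τ l a) :=
  Function.iterate_add_apply _ _ _ _

variable {τ} in
theorem shiftBy_mem_subshift {x : ℤ → A} (hx : x ∈ subshift τ) (k : ℤ) :
    shiftBy k x ∈ subshift τ := fun i n => by
  rw [wordAt_shiftBy]
  exact hx (i + k) n

variable [NeZero p]

theorem onWord_wordAt (x : ℤ → A) (i : ℤ) (n : ℕ) :
    onWord τ (wordAt x i n) = wordAt (onSeq τ x) (p * i) (p * n) := by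
  induction n with
  | zero => simp [onWord, wordAt]
  | succ n ih =>
    have hletter : onWord τ (wordAt x (i + n) 1) = wordAt (onSeq τ x) (p * (i + n)) p := by
      refine List.ext_getElem (by simp [onWord, wordAt]) fun j _ hj => ?_
      rw [getElem_wordAt, onSeq_apply τ x (i + n) ⟨j, by simpa using hj⟩]
      simp [onWord, wordAt]
    rw [wordAt_add, onWord_append, ih, hletter, mul_add_one, wordAt_add, mul_add]
    push_cast
    rfl

theorem iterate_onWord_wordAt (k : ℕ) (x : ℤ → A) (i : ℤ) (n : ℕ) :
    (onWord τ)^[k] (wordAt x i n) = wordAt ((onSeq τ)^[k] x) (p ^ k * i) (p ^ k * n) := by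
  induction k with
  | zero => simp
  | succ k ih =>
    simp only [Function.iterate_succ_apply', ih, onWord_wordAt, pow_succ', mul_assoc]

theorem iterWord_apply (k : ℕ) (x : ℤ → A) (q : ℤ) :
    iterWord τ k (x q) = wordAt ((onSeq τ)^[k] x) (p ^ k * q) (p ^ k) := by
  simpa [wordAt, iterWord] using iterate_onWord_wordAt τ k x q 1

theorem iterWord_eq (k : ℕ) (a : A) : iterWord τ k a = wordAt (iterLetter τ k a) 0 (p ^ k) := by
  simpa [iterLetter] using iterWord_apply τ k (fun _ => a) 0

variable {τ}

theorem onWord_injective (hinj : Function.Injective τ) : Function.Injective (onWord τ) := by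
  have hp := Nat.pos_of_neZero p
  intro v
  induction v with
  | nil =>
    rintro (_ | ⟨b, w⟩) h
    · rfl
    · have := congrArg List.length h
      simp only [onWord, List.flatMap_nil, List.length_nil, List.flatMap_cons, List.length_append,
        List.length_ofFn] at this
      omega
  | cons a v ih =>
    rintro (_ | ⟨b, w⟩) h
    · have := congrArg List.length h
      simp only [onWord, List.flatMap_nil, List.length_nil, List.flatMap_cons, List.length_append,
        List.length_ofFn] at this
      omega
    · obtain ⟨hhead, htail⟩ := List.append_inj (by simpa [onWord] using h) (by simp)
      rw [hinj (List.ofFn_injective hhead), ih htail]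

theorem onSeq_mem_subshift {x : ℤ → A} (hx : x ∈ subshift τ) : onSeq τ x ∈ subshift τ := by
  intro i n
  obtain ⟨q, r, rfl⟩ := exists_eq_mul_add (p := p) i
  obtain ⟨k, a, h⟩ := hx q (n + 1)
  have hsub : wordAt (onSeq τ x) (p * q + (r : ℕ)) n <:+:
      wordAt (onSeq τ x) (p * q) (p * (n + 1)) := by
    refine wordAt_infix_wordAt _ (by omega) ?_
    have hr : (r : ℕ) + n ≤ p * (n + 1) := by nlinarith [r.2]
    rw [add_assoc]
    exact_mod_cast Int.add_le_add_left (by exact_mod_cast hr) _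
  refine ⟨1 + k, a, hsub.trans ?_⟩
  rw [iterWord_add, ← onWord_wordAt]
  exact iterate_onWord_infix τ h 1

theorem exists_wordAt_eq_iterWord {x : ℤ → A} (hx : x ∈ subshift τ) (k : ℕ) :
    ∃ (a : A) (i : ℤ), wordAt x i (p ^ k) = iterWord τ k a := by
  obtain ⟨l, b, hl⟩ := hx 0 (2 * p ^ k)
  rw [iterWord_eq, infix_wordAt_iff, length_wordAt] at hl
  obtain ⟨m, hm, hmx⟩ := hl
  have hp := Nat.pow_pos (n := k) (Nat.pos_of_neZero p)
  have hkl : k ≤ l := by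
    by_contra! h
    have := Nat.pow_le_pow_right (Nat.pos_of_neZero p) h.le
    omega
  obtain ⟨d, rfl⟩ := Nat.exists_eq_add_of_le hkl
  -- the first occurrence of a word `τᵏ(a)` in `τᵏ(τᵈ(b))` to the right of the coordinate `m`
  obtain ⟨e, he⟩ : ∃ e : ℕ, m + e = p ^ k * (m / p ^ k + 1) :=
    Nat.exists_eq_add_of_le' (Nat.lt_mul_div_succ m hp).le |>.imp fun e he => by omega
  have hep : e ≤ p ^ k := by
    have := Nat.mul_div_le m (p ^ k)
    rw [mul_add, mul_one] at he
    omega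
  refine ⟨iterLetter τ d b (m / p ^ k + 1 : ℕ), e, ?_⟩
  calc wordAt x e (p ^ k)
      = wordAt (iterLetter τ (k + d) b) ((m + e : ℕ) : ℤ) (p ^ k) := by
        simpa using (wordAt_add_eq_of_wordAt_eq hmx (by omega : e + p ^ k ≤ 2 * p ^ k)).symm
    _ = iterWord τ k (iterLetter τ d b (m / p ^ k + 1 : ℕ)) := by
        rw [he, iterLetter, Function.iterate_add_apply, iterWord_apply]
        push_cast
        rfl

/-- Minimality of `X_τ`. -/
theorem exists_wordAt_eq (hprim : IsPrimitive τ) {x y : ℤ → A} (hx : x ∈ subshift τ)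
    (hy : y ∈ subshift τ) (i : ℤ) (n : ℕ) : ∃ j : ℤ, wordAt y j n = wordAt x i n := by
  obtain ⟨k, a, hk⟩ := hx i n
  obtain ⟨l, hl⟩ := hprim
  obtain ⟨c, j, hj⟩ := exists_wordAt_eq_iterWord hy (k + l)
  have ha : iterWord τ k a <:+: wordAt y j (p ^ (k + l)) := by
    rw [hj, iterWord_add]
    exact iterate_onWord_infix τ ((List.singleton_infix_iff a _).2 (hl a c)) k
  obtain ⟨m, -, hm⟩ := infix_wordAt_iff.1 (hk.trans ha)
  exact ⟨j + m, by simpa using hm⟩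

theorem exists_eqOn_shiftBy (hprim : IsPrimitive τ) {x y : ℤ → A} (hx : x ∈ subshift τ)
    (hy : y ∈ subshift τ) (N : ℕ) : ∃ d : ℤ, Set.EqOn x (shiftBy d y) (Set.Icc (-N) N) := by
  obtain ⟨j, hj⟩ := exists_wordAt_eq hprim hx hy (-N) (2 * N + 1)
  refine ⟨_, (eqOn_Ico_of_wordAt_eq hj.symm).mono fun l hl => ?_⟩
  simp only [Set.mem_Icc, Set.mem_Ico] at hl ⊢
  omega

theorem exists_mem_subshift_apply_zero (hprim : IsPrimitive τ) (hne : (subshift τ).Nonempty)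
    (a : A) : ∃ x ∈ subshift τ, x 0 = a := by
  obtain ⟨x, hx⟩ := hne
  obtain ⟨n, hn⟩ := hprim
  obtain ⟨c, i, hi⟩ := exists_wordAt_eq_iterWord hx n
  obtain ⟨j, -, hj⟩ := List.mem_map.1 (hi ▸ hn a c : a ∈ wordAt x i (p ^ n))
  exact ⟨shiftBy (i + j) x, shiftBy_mem_subshift hx _, by simpa using hj⟩

end Words

/-! ### Topology and minimality -/

section Topology

variable {A : Type*} [TopologicalSpace A]

theorem continuous_shiftBy (k : ℤ) : Continuous (shiftBy k : (ℤ → A) → ℤ → A) :=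
  continuous_pi fun n => continuous_apply (n + k)

variable [DiscreteTopology A]

theorem isClopen_eqOn {X : Type*} [TopologicalSpace X] {f g : X → ℤ → A} (hf : Continuous f)
    (hg : Continuous g) {s : Set ℤ} (hs : s.Finite) : IsClopen {u | Set.EqOn (f u) (g u) s} := by
  have hcoord : ∀ j, IsClopen {u | f u j = g u j} := fun j =>
    (isClopen_discrete (Set.diagonal A)).preimage
      (((continuous_apply j).comp hf).prodMk ((continuous_apply j).comp hg))
  convert hs.isClopen_biInter fun j _ => hcoord j using 1
  ext u
  simp [Set.EqOn]

theorem hasBasis_nhdsSet_diagonal {X : Type*} [TopologicalSpace X] [CompactSpace X]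
    {f : X → ℤ → A} (hf : Continuous f) (hinj : Function.Injective f) :
    (𝓝ˢ (Set.diagonal X)).HasBasis (fun _ : ℕ => True)
      fun N => {q | Set.EqOn (f q.1) (f q.2) (Set.Icc (-N) N)} := by
  have hclopen : ∀ N : ℕ, IsClopen {q : X × X | Set.EqOn (f q.1) (f q.2) (Set.Icc (-N) N)} :=
    fun N => isClopen_eqOn (hf.comp continuous_fst) (hf.comp continuous_snd) (Set.finite_Icc _ _)
  have hanti : Antitone fun N : ℕ => {q : X × X | Set.EqOn (f q.1) (f q.2) (Set.Icc (-N) N)} :=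
    fun M N hMN q hq => hq.mono (Set.Icc_subset_Icc (by omega) (by omega))
  refine ⟨fun U => ⟨fun hU => ?_, ?_⟩⟩
  · obtain ⟨N, hN⟩ := exists_subset_nhds_of_isCompact' hanti.directed_ge
      (fun N => (hclopen N).isClosed.isCompact) (fun N => (hclopen N).isClosed) (U := U)
      fun q hq => mem_nhdsSet_iff_forall.1 hU q <| hinj <| funext fun j =>
        Set.mem_iInter.1 hq j.natAbs ⟨by omega, by omega⟩
    exact ⟨N, trivial, hN⟩
  · rintro ⟨N, -, hN⟩
    refine mem_of_superset ((hclopen N).isOpen.mem_nhdsSet.2 ?_) hN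
    rintro ⟨x, y⟩ (rfl : x = y)
    exact Set.eqOn_refl _ _

theorem exists_window_of_disjoint [Finite A] {K L : Set (ℤ → A)} (hK : IsClosed K)
    (hL : IsClosed L) (hKL : Disjoint K L) :
    ∃ N : ℕ, ∀ x ∈ K, ∀ y ∈ L, ¬ Set.EqOn x y (Set.Icc (-N) N) := by
  have hnhds : (K ×ˢ L)ᶜ ∈ 𝓝ˢ (Set.diagonal (ℤ → A)) := by
    refine (hK.prod hL).isOpen_compl.mem_nhdsSet.2 ?_
    rintro ⟨x, y⟩ (rfl : x = y) hx
    exact hKL.le_bot hx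
  obtain ⟨N, -, hN⟩ := (hasBasis_nhdsSet_diagonal continuous_id Function.injective_id).mem_iff.1
    hnhds
  exact ⟨N, fun x hx y hy hxy => hN (a := (x, y)) hxy ⟨hx, hy⟩⟩

theorem mem_of_isClosed_of_eqOn [Finite A] {K : Set (ℤ → A)} (hK : IsClosed K) {x : ℤ → A}
    (h : ∀ N : ℕ, ∃ y ∈ K, Set.EqOn x y (Set.Icc (-N) N)) : x ∈ K := by
  by_contra hx
  obtain ⟨N, hN⟩ := exists_window_of_disjoint isClosed_singleton hK
    (Set.disjoint_singleton_left.2 hx)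
  obtain ⟨y, hy, hxy⟩ := h N
  exact hN x rfl y hy hxy

variable {p : ℕ} (τ : A → Fin p → A)

theorem isClosed_subshift : IsClosed (subshift τ) := by
  have hword : ∀ (i : ℤ) (n : ℕ), IsClosed {x : ℤ → A | ∃ k a, wordAt x i n <:+: iterWord τ k a} :=
    fun i n => by
      have hcont : Continuous fun x : ℤ → A => fun j : Fin n => x (i + (j : ℕ)) :=
        continuous_pi fun j => continuous_apply _
      convert (isClosed_discrete
        {w : Fin n → A | ∃ k a, List.ofFn w <:+: iterWord τ k a}).preimage hcont using 1
      ext x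
      simp [wordAt, List.ofFn_eq_map, ← List.map_coe_finRange_eq_range, Function.comp_def]
  simpa only [subshift, Set.ofPred_forall] using
    isClosed_iInter fun i => isClosed_iInter fun n => hword i n

theorem isCompact_subshift [Finite A] : IsCompact (subshift τ) :=
  (isClosed_subshift τ).isCompact

variable [NeZero p]

theorem continuous_onSeq : Continuous (onSeq τ) :=
  continuous_pi fun n =>
    (continuous_of_discreteTopology (f := fun a => τ a _)).comp (continuous_apply (n / (p : ℤ)))

theorem isClosed_image_onSeq [Finite A] (k : ℕ) (e : ℤ) :
    IsClosed ((fun u => shiftBy e ((onSeq τ)^[k] u)) '' subshift τ) :=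
  ((isCompact_subshift τ).image
    ((continuous_shiftBy e).comp ((continuous_onSeq τ).iterate k))).isClosed

variable {τ}

/-- Minimality of `X_τ`, in topological form. -/
theorem mem_of_isClosed_of_orbit_mem [Finite A] (hprim : IsPrimitive τ) {K : Set (ℤ → A)}
    (hK : IsClosed K) {x y : ℤ → A} (hx : x ∈ subshift τ) (hy : y ∈ subshift τ)
    (horbit : ∀ d, shiftBy d y ∈ K) : x ∈ K :=
  mem_of_isClosed_of_eqOn hK fun N => by
    obtain ⟨d, hd⟩ := exists_eqOn_shiftBy hprim hx hy N
    exact ⟨_, horbit d, hd⟩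

end Topology

section Cutting

variable {A : Type*} [Finite A] {p : ℕ} [NeZero p] {τ : A → Fin p → A}

theorem exists_eq_shiftBy_onSeq (hprim : IsPrimitive τ) {x : ℤ → A} (hx : x ∈ subshift τ) :
    ∃ y ∈ subshift τ, ∃ r : Fin p, x = shiftBy (r : ℕ) (onSeq τ y) := by
  let : TopologicalSpace A := ⊥
  have : DiscreteTopology A := ⟨rfl⟩
  have hclosed : IsClosed (⋃ r : Fin p, (fun y => shiftBy (r : ℕ) (onSeq τ y)) '' subshift τ) :=
    isClosed_iUnion_of_finite fun r => isClosed_image_onSeq τ 1 _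
  have hmem := mem_of_isClosed_of_orbit_mem hprim hclosed hx (onSeq_mem_subshift hx) fun d => by
    obtain ⟨q, r, rfl⟩ := exists_eq_mul_add (p := p) d
    refine Set.mem_iUnion.2 ⟨r, shiftBy q x, shiftBy_mem_subshift hx q, ?_⟩
    simp only [onSeq_shiftBy, shiftBy_shiftBy, add_comm]
  obtain ⟨r, y, hy, hxy⟩ := Set.mem_iUnion.1 hmem
  exact ⟨y, hy, r, hxy.symm⟩

end Cutting

/-! ### Recognizability -/

section Recognizability

variable {A : Type*} {p : ℕ}

/-- The sliding block code with local rule `f` on two consecutive letters. -/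
def blockCode (f : A → A → A) (x : ℤ → A) : ℤ → A := fun n => f (x n) (x (n + 1))

theorem finite_of_shiftBy_eq_self [Finite A] {X : Set (ℤ → A)} {e : ℤ} (he : e ≠ 0)
    (h : ∀ x ∈ X, shiftBy e x = x) : X.Finite := by
  have hper : ∀ x ∈ X, ∀ n : ℤ, x n = x (n % e) := fun x hx n => by
    have hx : Function.Periodic x e := fun n => congrFun (h x hx) n
    conv_lhs => rw [← Int.emod_add_mul_ediv n e, mul_comm]
    exact hx.int_mul (n / e) (n % e)
  refine Set.Finite.of_finite_image (f := fun x => (Set.Ico 0 |e|).domRestrict x)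
    (Set.toFinite _) fun x hx y hy hxy => funext fun n => ?_
  rw [hper x hx, hper y hy]
  exact congrFun hxy ⟨n % e, Int.emod_nonneg n he, Int.emod_lt_abs n he⟩

variable [NeZero p]

/-- The integers `e` with `Tᵉ τᵏ(X_τ) ⊆ τᵏ(X_τ)`. Recognizability says that for `k = 1` these are
the multiples of `p`. -/
def returnTimes (τ : A → Fin p → A) (k : ℕ) : AddSubmonoid ℤ where
  carrier := {e | ∀ u ∈ subshift τ, ∃ v ∈ subshift τ, shiftBy e ((onSeq τ)^[k] u) = (onSeq τ)^[k] v}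
  zero_mem' u hu := ⟨u, hu, shiftBy_zero _⟩
  add_mem' {d e} hd he u hu := by
    obtain ⟨v, hv, huv⟩ := he u hu
    obtain ⟨w, hw, hvw⟩ := hd v hv
    exact ⟨w, hw, by rw [← shiftBy_shiftBy, huv, hvw]⟩

/-- Recognizability: every point of `X_τ` is `Tʳ τ(y)` for a unique point `y` of `X_τ` and a
unique `r` in `{0, …, p - 1}`. -/
def IsRecognizable (τ : A → Fin p → A) : Prop :=
  ∀ x ∈ subshift τ, ∃! q : (ℤ → A) × Fin p,
    q.1 ∈ subshift τ ∧ x = shiftBy (q.2 : ℕ) (onSeq τ q.1)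

variable {τ : A → Fin p → A}

theorem exists_blockCode_of_mem_returnTimes (hinj : Function.Injective τ) {n e : ℕ}
    (he : (e : ℤ) ∈ returnTimes τ n) (hen : e ≤ p ^ n) (hne : (subshift τ).Nonempty) :
    ∃ f : A → A → A, ∀ u ∈ subshift τ, blockCode f u ∈ subshift τ ∧
      (onSeq τ)^[n] (blockCode f u) = shiftBy e ((onSeq τ)^[n] u) := by
  choose! R hRmem hR using he
  have hfactors : Function.FactorsThrough (fun q : subshift τ × ℤ => R q.1 q.2)
      fun q => (q.1.1 q.2, q.1.1 (q.2 + 1)) := by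
    rintro ⟨⟨u, hu⟩, i⟩ ⟨⟨v, hv⟩, j⟩ h
    obtain ⟨h0, h1⟩ : u i = v j ∧ u (i + 1) = v (j + 1) := by simpa using h
    have hpair : wordAt u i 2 = wordAt v j 2 := by simp [wordAt, List.range_succ, h0, h1]
    have hword := congrArg (onWord τ)^[n] hpair
    rw [iterate_onWord_wordAt, iterate_onWord_wordAt] at hword
    apply (onWord_injective hinj).iterate n |>.comp List.singleton_injective
    change iterWord τ n (R u i) = iterWord τ n (R v j)
    rw [iterWord_apply, iterWord_apply, ← hR u hu, ← hR v hv, wordAt_shiftBy, wordAt_shiftBy]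
    exact wordAt_add_eq_of_wordAt_eq hword (by omega)
  obtain ⟨u₀, -⟩ := hne
  have : Nonempty A := ⟨u₀ 0⟩
  obtain ⟨f, hf⟩ := (Function.factorsThrough_iff _).1 hfactors
  have hblock : ∀ u ∈ subshift τ, blockCode (Function.curry f) u = R u := fun u hu =>
    funext fun m => (congrFun hf (⟨u, hu⟩, m)).symm
  exact ⟨Function.curry f, fun u hu => hblock u hu ▸ ⟨hRmem u hu, (hR u hu).symm⟩⟩

theorem iterate_blockCode {f : A → A → A} {n e : ℕ}
    (hf : ∀ u ∈ subshift τ, blockCode f u ∈ subshift τ ∧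
      (onSeq τ)^[n] (blockCode f u) = shiftBy e ((onSeq τ)^[n] u))
    (i : ℕ) {u : ℤ → A} (hu : u ∈ subshift τ) :
    (onSeq τ)^[n] ((blockCode f)^[i] u) = shiftBy (i * e) ((onSeq τ)^[n] u) := by
  have hmaps : Set.MapsTo (blockCode f) (subshift τ) (subshift τ) := fun u hu => (hf u hu).1
  induction i with
  | zero => simp
  | succ i ih =>
    rw [Function.iterate_succ_apply', (hf _ (hmaps.iterate i hu)).2, ih, shiftBy_shiftBy]
    push_cast
    ring_nf

theorem iterate_blockCode_pow (hinj : Function.Injective τ) {f : A → A → A} {n e : ℕ}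
    (hf : ∀ u ∈ subshift τ, blockCode f u ∈ subshift τ ∧
      (onSeq τ)^[n] (blockCode f u) = shiftBy e ((onSeq τ)^[n] u))
    (i : ℕ) {u : ℤ → A} (hu : u ∈ subshift τ) :
    (blockCode f)^[p ^ (n + i)] u = shiftBy (p ^ i * e) u := by
  apply (onSeq_injective hinj).iterate n
  rw [iterate_blockCode hf _ hu, iterate_onSeq_shiftBy, pow_add]
  push_cast
  rw [mul_assoc]

variable [Finite A]

theorem mem_returnTimes_of_eq (hprim : IsPrimitive τ) {k : ℕ} {e : ℤ} {u v : ℤ → A}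
    (hu : u ∈ subshift τ) (hv : v ∈ subshift τ)
    (h : shiftBy e ((onSeq τ)^[k] u) = (onSeq τ)^[k] v) : e ∈ returnTimes τ k := by
  let : TopologicalSpace A := ⊥
  have : DiscreteTopology A := ⟨rfl⟩
  intro w hw
  have hclosed : IsClosed {w | shiftBy e ((onSeq τ)^[k] w) ∈ (onSeq τ)^[k] '' subshift τ} := by
    have := isClosed_image_onSeq τ k 0
    simp only [shiftBy_zero] at this
    exact this.preimage ((continuous_shiftBy e).comp ((continuous_onSeq τ).iterate k))
  obtain ⟨w', hw', hww'⟩ := mem_of_isClosed_of_orbit_mem hprim hclosed hw hu fun d =>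
    ⟨shiftBy d v, shiftBy_mem_subshift hv d, by
      simp only [iterate_onSeq_shiftBy, shiftBy_shiftBy, ← h, add_comm]⟩
  exact ⟨w', hw', hww'.symm⟩

theorem mul_mem_returnTimes_succ (hprim : IsPrimitive τ) (hne : (subshift τ).Nonempty) {n j : ℕ}
    {e : ℤ} (hj : (j : ℤ) ∈ returnTimes τ 1) (he : e ∈ returnTimes τ n) :
    j * e ∈ returnTimes τ (n + 1) := by
  obtain ⟨u, hu⟩ := hne
  obtain ⟨w, hw, huw⟩ := he _ (onSeq_mem_subshift hu)
  obtain ⟨v, hv, r, rfl⟩ := exists_eq_shiftBy_onSeq hprim hw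
  have hdiff : e - p ^ n * (r : ℕ) ∈ returnTimes τ (n + 1) := by
    refine mem_returnTimes_of_eq hprim hu hv (shiftBy_injective (p ^ n * (r : ℕ)) ?_)
    rw [shiftBy_shiftBy, add_sub_cancel, Function.iterate_succ_apply, huw, iterate_onSeq_shiftBy,
      Function.iterate_succ_apply]
  have hmul : (j : ℤ) * (p ^ n * (r : ℕ)) ∈ returnTimes τ (n + 1) := fun u hu => by
    obtain ⟨v, hv, huv⟩ := nsmul_mem hj (r : ℕ) u hu
    refine ⟨v, hv, ?_⟩
    simp only [Function.iterate_one, nsmul_eq_mul] at huv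
    rw [Function.iterate_succ_apply, Function.iterate_succ_apply, ← huv, iterate_onSeq_shiftBy]
    ring_nf
  have := add_mem (nsmul_mem hdiff j) hmul
  rwa [nsmul_eq_mul, ← mul_add, sub_add_cancel] at this

theorem pow_mem_returnTimes (hprim : IsPrimitive τ) (hne : (subshift τ).Nonempty) {j : ℕ}
    (hj : (j : ℤ) ∈ returnTimes τ 1) (n : ℕ) : ((j ^ n : ℕ) : ℤ) ∈ returnTimes τ n := by
  induction n with
  | zero => exact fun u hu => ⟨_, shiftBy_mem_subshift hu _, rfl⟩
  | succ n ih =>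
    rw [pow_succ', Nat.cast_mul]
    exact mul_mem_returnTimes_succ hprim hne hj ih

theorem eq_zero_of_mem_returnTimes (hinj : Function.Injective τ) (hprim : IsPrimitive τ)
    (hinf : (subshift τ).Infinite) {j : ℕ} (hj : (j : ℤ) ∈ returnTimes τ 1) (hjp : j < p) :
    j = 0 := by
  by_contra hj0
  choose f hf using fun n => exists_blockCode_of_mem_returnTimes hinj
    (pow_mem_returnTimes hprim hinf.nonempty hj n) (Nat.pow_le_pow_left hjp.le n) hinf.nonempty
  obtain ⟨n, m, hnm, hfeq⟩ : ∃ n m, n < m ∧ f n = f m :=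
    Set.finite_univ.exists_lt_map_eq_of_forall_mem fun n => Set.mem_univ (f n)
  obtain ⟨d, rfl⟩ := Nat.exists_eq_add_of_lt hnm
  have hexp : j ^ (n + d + 1) < p ^ (d + 1) * j ^ n := by
    rw [add_assoc, pow_add, mul_comm]
    exact Nat.mul_lt_mul_of_pos_right (Nat.pow_lt_pow_left hjp d.succ_ne_zero)
      (Nat.pow_pos (Nat.pos_of_ne_zero hj0))
  refine hinf (finite_of_shiftBy_eq_self
    (e := (p ^ (d + 1) * j ^ n : ℕ) - (j ^ (n + d + 1) : ℕ)) (by omega) fun x hx => ?_)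
  have hn := iterate_blockCode_pow hinj (hf n) (d + 1) hx
  have hm := iterate_blockCode_pow hinj (hf (n + d + 1)) 0 hx
  rw [hfeq, ← add_assoc] at hn
  rw [add_zero, hn] at hm
  apply shiftBy_injective (j ^ (n + d + 1) : ℕ)
  simpa using hm

theorem isRecognizable_of_infinite (hinj : Function.Injective τ) (hprim : IsPrimitive τ)
    (hinf : (subshift τ).Infinite) : IsRecognizable τ := by
  have hdigit : ∀ {u v : ℤ → A} {r s : Fin p}, u ∈ subshift τ → v ∈ subshift τ →
      shiftBy (r : ℕ) (onSeq τ u) = shiftBy (s : ℕ) (onSeq τ v) → r ≤ s := by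
    intro u v r s hu hv h
    by_contra! hsr
    obtain ⟨d, hd⟩ := Nat.exists_eq_add_of_lt (Fin.lt_def.1 hsr)
    have hmem : ((d + 1 : ℕ) : ℤ) ∈ returnTimes τ 1 := by
      refine mem_returnTimes_of_eq hprim hu hv (shiftBy_injective (s : ℕ) ?_)
      rw [Function.iterate_one, ← h, hd, shiftBy_shiftBy]
      push_cast
      rw [add_assoc]
    exact absurd (eq_zero_of_mem_returnTimes hinj hprim hinf hmem (by omega)) d.succ_ne_zero
  intro x hx
  obtain ⟨y, hy, r, rfl⟩ := exists_eq_shiftBy_onSeq hprim hx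
  refine ⟨(y, r), ⟨hy, rfl⟩, ?_⟩
  rintro ⟨z, s⟩ ⟨hz, h⟩
  obtain rfl : r = s := le_antisymm (hdigit hy hz h) (hdigit hz hy h.symm)
  rw [onSeq_injective hinj (shiftBy_injective _ h)]

end Recognizability

/-! ### Addition in the odometer -/

section Digits

variable {p : ℕ} (δ : ℕ → Fin p)

/-- The number `∑_{j < i} δ_j pʲ`: the position of the coordinate `0` of `x` in its block
`τⁱ(x⁽ⁱ⁾₀)`, when `δ` are the digits of `x`. -/
def offset (i : ℕ) : ℕ := ∑ j ∈ Finset.range i, (δ j : ℕ) * p ^ j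

/-- The number `pⁱ - ∑_{j < i} δ_j pʲ`: the first coordinate of `x` on the right of its block
`τⁱ(x⁽ⁱ⁾₀)`. It is written so as to be the length of `x₀ s₀(x) τ(s₁(x)) ⋯ τⁱ⁻¹(s_{i-1}(x))`. -/
def reach (i : ℕ) : ℕ := 1 + ∑ j ∈ Finset.range i, (p - 1 - (δ j : ℕ)) * p ^ j

theorem offset_succ (i : ℕ) : offset δ (i + 1) = offset δ i + (δ i : ℕ) * p ^ i :=
  Finset.sum_range_succ _ _

theorem reach_succ (i : ℕ) : reach δ (i + 1) = reach δ i + (p - 1 - (δ i : ℕ)) * p ^ i := by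
  rw [reach, Finset.sum_range_succ, ← add_assoc, reach]

theorem reach_add_offset (i : ℕ) : reach δ i + offset δ i = p ^ i := by
  induction i with
  | zero => simp [reach, offset]
  | succ i ih =>
    obtain ⟨c, hc⟩ : ∃ c, p = δ i + 1 + c := Nat.exists_eq_add_of_le (δ i).2
    have hsub : p - 1 - (δ i : ℕ) = c := by omega
    calc reach δ (i + 1) + offset δ (i + 1)
        = (reach δ i + offset δ i) + (c + δ i) * p ^ i := by
          rw [reach_succ, offset_succ, hsub]
          ring
      _ = p ^ i * (δ i + 1 + c) := by rw [ih]; ring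
      _ = p ^ (i + 1) := by rw [← hc, pow_succ]

theorem reach_mono : Monotone (reach δ) :=
  monotone_nat_of_le_succ fun i => by rw [reach_succ]; omega

theorem reach_pos (i : ℕ) : 0 < reach δ i := by
  rw [reach]; omega

variable {δ} in
theorem tendsto_reach (h : {i | (δ i : ℕ) ≠ p - 1}.Infinite) : Tendsto (reach δ) atTop atTop := by
  refine tendsto_atTop_atTop_of_monotone (reach_mono δ) fun b => ?_
  induction b with
  | zero => exact ⟨0, Nat.zero_le _⟩
  | succ b ih =>
    obtain ⟨i, hi⟩ := ih
    obtain ⟨j, hj, hij⟩ := h.exists_gt i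
    refine ⟨j + 1, ?_⟩
    have hlt : (δ j : ℕ) < p - 1 := lt_of_le_of_ne (Nat.le_sub_one_of_lt (δ j).2) hj
    have hstep : 0 < (p - 1 - (δ j : ℕ)) * p ^ j :=
      Nat.mul_pos (by omega) (Nat.pow_pos (by omega))
    have := reach_mono δ hij.le
    rw [reach_succ]
    omega

theorem pow_dvd_reach_add_offset {i M : ℕ} (h : i ≤ M) : p ^ i ∣ reach δ M + offset δ i := by
  induction M, h using Nat.le_induction with
  | base => rw [reach_add_offset]
  | succ M hM ih =>
    rw [reach_succ, add_right_comm]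
    exact ih.add ((pow_dvd_pow p hM).mul_left _)

/-- The carry into the place `i` in the addition of `k` to the `p`-adic integer with digits `δ`. -/
def carry (k i : ℕ) : ℕ := (k + offset δ i) / p ^ i

theorem carry_zero (k : ℕ) : carry δ k 0 = k := by
  simp [carry, offset]

variable [NeZero p]

theorem carry_add_digit (k i : ℕ) : carry δ k i + δ i = (k + offset δ (i + 1)) / p ^ i := by
  rw [carry, offset_succ, ← add_assoc,
    Nat.add_mul_div_right _ _ (Nat.pow_pos (Nat.pos_of_neZero p))]

theorem carry_succ (k i : ℕ) : carry δ k (i + 1) = (carry δ k i + δ i) / p := by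
  rw [carry_add_digit, Nat.div_div_eq_div_mul, ← pow_succ, carry]

/-- The digits of the sum of `k` and the `p`-adic integer with the digits `δ`. -/
def addDigits (k : ℕ) : ℕ → Fin p := fun i => Fin.ofNat p (carry δ k i + δ i)

theorem carry_add_digit_eq (k i : ℕ) :
    carry δ k i + δ i = p * carry δ k (i + 1) + addDigits δ k i := by
  rw [carry_succ, addDigits, Fin.val_ofNat, Nat.div_add_mod]

theorem addDigits_reach {M j : ℕ} (hj : j < M) : addDigits δ (reach δ M) j = 0 := by
  obtain ⟨c, hc⟩ := pow_dvd_reach_add_offset δ (Nat.succ_le_of_lt hj)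
  rw [addDigits, carry_add_digit, hc, pow_succ, mul_assoc,
    Nat.mul_div_cancel_left _ (Nat.pow_pos (Nat.pos_of_neZero p))]
  exact Fin.ext (by simp)

end Digits

/-! ### Desubstitution -/

section Desubstitution

variable {A : Type*} {p : ℕ} {τ : A → Fin p → A}

theorem length_iterate_onWord (k : ℕ) (w : List A) :
    ((onWord τ)^[k] w).length = p ^ k * w.length := by
  induction k with
  | zero => simp
  | succ k ih =>
    rw [Function.iterate_succ_apply', onWord, List.length_flatMap]
    simp only [List.length_ofFn, List.map_const', List.sum_replicate, smul_eq_mul, ih, pow_succ]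
    ring

variable [NeZero p] {x y : ℤ → A} {xs ys : ℕ → ℤ → A} {δ ε : ℕ → Fin p}

theorem isDesubstitution_iff :
    IsDesubstitution τ x xs δ ↔ xs 0 = x ∧ (∀ i, xs i ∈ subshift τ) ∧
      ∀ i, xs i = shiftBy (δ i : ℕ) (onSeq τ (xs (i + 1))) := by
  refine and_congr_right fun _ => and_congr_right fun _ => forall_congr' fun i => ?_
  change _ = shiftBy (-(δ i : ℕ)) (xs i) ↔ _
  rw [← (shiftBy_injective (δ i : ℕ)).eq_iff, shiftBy_shiftBy, add_neg_cancel, shiftBy_zero,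
    eq_comm]

namespace IsDesubstitution

theorem mem_subshift (hx : IsDesubstitution τ x xs δ) : x ∈ subshift τ :=
  hx.1 ▸ hx.2.1 0

theorem eq_shiftBy_onSeq (hx : IsDesubstitution τ x xs δ) (i : ℕ) :
    xs i = shiftBy (δ i : ℕ) (onSeq τ (xs (i + 1))) :=
  (isDesubstitution_iff.1 hx).2.2 i

theorem shiftBy_addDigits (hx : IsDesubstitution τ x xs δ) (k : ℕ) :
    IsDesubstitution τ (shiftBy k x) (fun i => shiftBy (carry δ k i) (xs i)) (addDigits δ k) := by
  refine isDesubstitution_iff.2 ⟨by rw [carry_zero, hx.1],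
    fun i => shiftBy_mem_subshift (hx.2.1 i) _, fun i => ?_⟩
  have hcarry := carry_add_digit_eq δ k i
  rw [onSeq_shiftBy, shiftBy_shiftBy, hx.eq_shiftBy_onSeq i, shiftBy_shiftBy]
  congr 1
  zify at hcarry
  linarith

theorem eq_shiftBy_offset (hx : IsDesubstitution τ x xs δ) (i : ℕ) :
    x = shiftBy (offset δ i) ((onSeq τ)^[i] (xs i)) := by
  induction i with
  | zero => simp [offset, hx.1]
  | succ i ih =>
    rw [ih, hx.eq_shiftBy_onSeq i, iterate_onSeq_shiftBy, shiftBy_shiftBy,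
      ← Function.iterate_succ_apply (onSeq τ), offset_succ]
    push_cast
    rw [mul_comm]

theorem unique (hrec : IsRecognizable τ) (hx : IsDesubstitution τ x xs δ)
    (hy : IsDesubstitution τ x ys ε) : xs = ys ∧ δ = ε := by
  have hstep : ∀ i, xs i = ys i → (xs (i + 1), δ i) = (ys (i + 1), ε i) := fun i h =>
    (hrec _ (hx.2.1 i)).unique ⟨hx.2.1 _, hx.eq_shiftBy_onSeq i⟩
      ⟨hy.2.1 _, h ▸ hy.eq_shiftBy_onSeq i⟩
  have hxs : ∀ i, xs i = ys i := fun i => by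
    induction i with
    | zero => rw [hx.1, hy.1]
    | succ i ih => exact (Prod.mk.inj (hstep i ih)).1
  exact ⟨funext hxs, funext fun i => (Prod.mk.inj (hstep i (hxs i))).2⟩

end IsDesubstitution

theorem exists_isDesubstitution (hrec : IsRecognizable τ) (hx : x ∈ subshift τ) :
    ∃ q : (ℕ → ℤ → A) × (ℕ → Fin p), IsDesubstitution τ x q.1 q.2 := by
  choose! q hq using fun x hx => (hrec x hx).exists
  have hmem : ∀ i, (fun x => (q x).1)^[i] x ∈ subshift τ := fun i =>
    Set.MapsTo.iterate (fun x hx => (hq x hx).1) i hx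
  refine ⟨(fun i => (fun x => (q x).1)^[i] x, fun i => (q ((fun x => (q x).1)^[i] x)).2),
    isDesubstitution_iff.2 ⟨rfl, hmem, fun i => ?_⟩⟩
  simp only [Function.iterate_succ_apply']
  exact (hq _ (hmem i)).2

variable [Nonempty A]

theorem isDesubstitution_level (hrec : IsRecognizable τ) (hx : x ∈ subshift τ) :
    IsDesubstitution τ x (level τ x) (toOdometer τ x) :=
  Classical.epsilon_spec (exists_isDesubstitution hrec hx)

theorem IsDesubstitution.toOdometer_eq (hrec : IsRecognizable τ)
    (hx : IsDesubstitution τ x xs δ) : toOdometer τ x = δ :=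
  ((isDesubstitution_level hrec hx.mem_subshift).unique hrec hx).2

theorem toOdometer_shiftBy (hrec : IsRecognizable τ) (hx : x ∈ subshift τ) (k : ℕ) :
    toOdometer τ (shiftBy k x) = addDigits (toOdometer τ x) k :=
  ((isDesubstitution_level hrec hx).shiftBy_addDigits k).toOdometer_eq hrec

theorem iPlus_eq (x : ℤ → A) : iPlus τ x = {i | (toOdometer τ x i : ℕ) ≠ p - 1} := by
  ext i
  have := (toOdometer τ x i).2
  simp only [iPlus, sWord, length_wordAt, Set.mem_ofPred_eq]
  omega

theorem iPlus_congr (h : toOdometer τ x = toOdometer τ y) : iPlus τ x = iPlus τ y := by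
  rw [iPlus_eq, iPlus_eq, h]

theorem length_rightWord (x : ℤ → A) (i : ℕ) :
    (rightWord τ x i).length = reach (toOdometer τ x) (i + 1) := by
  simp only [rightWord, List.length_cons, List.length_flatMap, length_iterate_onWord, sWord,
    length_wordAt, reach, mul_comm (p - 1 - _)]
  rw [← List.sum_toFinset _ List.nodup_range, List.toFinset_range, add_comm]

theorem kPlus_eq_reach {M : ℕ} (hM : ∀ i ∈ iPlus τ x, i < M) :
    kPlus τ x = reach (toOdometer τ x) M := by
  simp only [kPlus, length_rightWord]
  refine le_antisymm (max_le (reach_pos _ _) (csSup_le' ?_)) ?_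
  · rintro _ ⟨i, hi, rfl⟩
    exact reach_mono _ (hM i hi)
  have hfin : (iPlus τ x).Finite := (Set.finite_lt_nat M).subset hM
  clear hM
  induction M with
  | zero => exact le_max_left _ _
  | succ M ih =>
    by_cases hM : M ∈ iPlus τ x
    · exact le_max_of_le_right (le_csSup (hfin.image _).bddAbove ⟨M, hM, rfl⟩)
    · rw [iPlus_eq, Set.mem_ofPred_eq, not_not] at hM
      rwa [reach_succ, hM, Nat.sub_self, zero_mul, add_zero]

theorem kPlus_congr (h : toOdometer τ x = toOdometer τ y) : kPlus τ x = kPlus τ y := by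
  simp only [kPlus, length_rightWord, iPlus_congr h, h]

theorem addDigits_kPlus (h : (iPlus τ x).Finite) : addDigits (toOdometer τ x) (kPlus τ x) = 0 := by
  obtain ⟨M, hM⟩ := h.bddAbove
  funext i
  rw [kPlus_eq_reach (M := M + i + 1) fun j hj => by have := hM hj; omega]
  exact addDigits_reach _ (by omega)

theorem infinite_iPlus_shiftBy_kPlus (hp : 2 ≤ p) (hrec : IsRecognizable τ) (hx : x ∈ subshift τ)
    (h : (iPlus τ x).Finite) : (iPlus τ (shiftBy (kPlus τ x) x)).Infinite := by
  rw [iPlus_eq, toOdometer_shiftBy hrec hx, addDigits_kPlus h]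
  convert Set.infinite_univ (α := ℕ) using 1
  refine Set.eq_univ_of_forall fun i => ?_
  simp only [Set.mem_ofPred_eq, Pi.zero_apply, Fin.coe_ofNat_eq_mod, Nat.zero_mod]
  omega

theorem exists_infinite_iPlus_shiftBy (hp : 2 ≤ p) (hrec : IsRecognizable τ)
    (hx : x ∈ subshift τ) : ∃ k : ℕ, (iPlus τ (shiftBy k x)).Infinite := by
  by_cases h : (iPlus τ x).Infinite
  · exact ⟨0, by simpa using h⟩
  · exact ⟨_, infinite_iPlus_shiftBy_kPlus hp hrec hx (Set.not_infinite.1 h)⟩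

end Desubstitution

/-! ### Pairs of points with the same digits -/

theorem frequently_exists_mem_Ico_iff {g : ℕ → ℕ} (hg : Monotone g) (hg' : Tendsto g atTop atTop)
    {P : ℕ → Prop} :
    (∃ᶠ i in atTop, ∃ n ∈ Set.Ico (g i) (g (i + 1)), P n) ↔ ∃ᶠ n in atTop, P n := by
  simp only [frequently_atTop]
  constructor
  · intro h N
    obtain ⟨I, hI⟩ := eventually_atTop.1 (hg'.eventually_ge_atTop N)
    obtain ⟨i, hi, n, hn, hPn⟩ := h I
    exact ⟨n, (hI i hi).trans hn.1, hPn⟩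
  · intro h I
    obtain ⟨n, hn, hPn⟩ := h (g I)
    have hcover : n ∈ ⋃ i, Set.Ico (g (I + i)) (g (I + Order.succ i)) := by
      rw [iUnion_Ico_map_succ_eq_Ici (f := fun i => g (I + i)) (fun i => hg (by simp))
        (not_bddAbove_of_tendsto_atTop
          (hg'.comp (tendsto_atTop_mono (Nat.le_add_left · I) tendsto_id)))]
      exact hn
    obtain ⟨i, hni⟩ := Set.mem_iUnion.1 hcover
    exact ⟨I + i, Nat.le_add_right _ _, n, hni, hPn⟩

section Fibre

variable {A : Type*} {p : ℕ} [NeZero p] {τ : A → Fin p → A}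

theorem iterLetter_injective (hcol : ∀ r, Function.Injective fun a => τ a r) (k : ℕ) (n : ℤ) :
    Function.Injective fun a => iterLetter τ k a n := by
  induction k generalizing n with
  | zero => exact fun a b h => h
  | succ k ih =>
    obtain ⟨q, r, rfl⟩ := exists_eq_mul_add (p := p) n
    simp only [iterLetter_succ_apply]
    exact (hcol r).comp (ih q)

theorem modEq_of_iterLetter_ne {r₀ : Fin p} (hcol : ∀ r ≠ r₀, ∀ a b, τ a r = τ b r) (k : ℕ)
    {a b : A} {m n : ℤ} (hm : iterLetter τ k a m ≠ iterLetter τ k b m)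
    (hn : iterLetter τ k a n ≠ iterLetter τ k b n) : m ≡ n [ZMOD p ^ k] := by
  induction k generalizing m n with
  | zero => rw [pow_zero]; exact Int.modEq_one
  | succ k ih =>
    obtain ⟨q, r, rfl⟩ := exists_eq_mul_add (p := p) m
    obtain ⟨q', r', rfl⟩ := exists_eq_mul_add (p := p) n
    rw [iterLetter_succ_apply, iterLetter_succ_apply] at hm hn
    have hr : r = r₀ := by_contra fun h => hm (hcol r h _ _)
    have hr' : r' = r₀ := by_contra fun h => hn (hcol r' h _ _)
    have hq : q ≡ q' [ZMOD p ^ k] :=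
      ih (fun h => hm (by rw [h])) (fun h => hn (by rw [h]))
    rw [hr, hr', pow_succ']
    exact hq.mul_left'.add_right _

namespace IsDesubstitution

variable {x y : ℤ → A} {xs ys : ℕ → ℤ → A} {δ : ℕ → Fin p}

theorem apply_eq_iterLetter (hx : IsDesubstitution τ x xs δ) (i : ℕ) (n : ℤ) :
    x n = iterLetter τ i (xs i ((n + offset δ i) / (p : ℤ) ^ i)) (n + offset δ i) := by
  conv_lhs => rw [hx.eq_shiftBy_offset i]
  rw [shiftBy_apply, iterate_onSeq_apply]

theorem apply_eq_iterLetter_zero (hx : IsDesubstitution τ x xs δ) {i n : ℕ} (hn : n < reach δ i) :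
    x n = iterLetter τ i (xs i 0) (n + offset δ i) := by
  have := reach_add_offset δ i
  rw [hx.apply_eq_iterLetter i, Int.ediv_eq_zero_of_lt (by positivity) (by norm_cast; omega)]

theorem apply_eq_iff_apply_zero_eq (hcol : ∀ r, Function.Injective fun a => τ a r)
    (hx : IsDesubstitution τ x xs δ) (hy : IsDesubstitution τ y ys δ)
    (hδ : {i | (δ i : ℕ) ≠ p - 1}.Infinite) (n : ℕ) : x n = y n ↔ x 0 = y 0 := by
  obtain ⟨i, hi⟩ := ((tendsto_reach hδ).eventually_gt_atTop n).exists
  have hlevel : ∀ m : ℕ, m < reach δ i → (x m = y m ↔ xs i 0 = ys i 0) := fun m hm => by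
    rw [hx.apply_eq_iterLetter_zero hm, hy.apply_eq_iterLetter_zero hm]
    exact (iterLetter_injective hcol i _).eq_iff
  exact (hlevel n hi).trans (hlevel 0 (reach_pos δ i)).symm

theorem eventually_eq {r₀ : Fin p} (hcol : ∀ r ≠ r₀, ∀ a b, τ a r = τ b r)
    (hx : IsDesubstitution τ x xs δ) (hy : IsDesubstitution τ y ys δ)
    (hδ : {i | (δ i : ℕ) ≠ p - 1}.Infinite) : ∀ᶠ n : ℕ in atTop, x n = y n := by
  have hsub : {n : ℕ | x n ≠ y n}.Subsingleton := fun m hm n hn => by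
    obtain ⟨i, hi⟩ := ((tendsto_reach hδ).eventually_gt_atTop (max m n)).exists
    rw [max_lt_iff] at hi
    rw [Set.mem_ofPred_eq, hx.apply_eq_iterLetter_zero hi.1, hy.apply_eq_iterLetter_zero hi.1] at hm
    rw [Set.mem_ofPred_eq, hx.apply_eq_iterLetter_zero hi.2, hy.apply_eq_iterLetter_zero hi.2] at hn
    have hmod : m + offset δ i ≡ n + offset δ i [MOD p ^ i] := by
      exact_mod_cast modEq_of_iterLetter_ne hcol i hm hn
    have := reach_add_offset δ i
    exact hmod.add_right_cancel'.eq_of_lt_of_lt (by omega) (by omega)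
  rw [← Nat.cofinite_eq_atTop]
  exact hsub.finite

theorem iterate_onWord_wordAt_one (hx : IsDesubstitution τ x xs δ) (i n : ℕ) :
    (onWord τ)^[i] (wordAt (xs i) 1 n) = wordAt x (reach δ i) (p ^ i * n) := by
  have hreach : (reach δ i : ℤ) + offset δ i = (p : ℤ) ^ i := mod_cast reach_add_offset δ i
  conv_rhs => rw [hx.eq_shiftBy_offset i]
  rw [wordAt_shiftBy, hreach, iterate_onWord_wordAt, mul_one]

theorem wordAt_ne_iff (hinj : Function.Injective τ) (hx : IsDesubstitution τ x xs δ)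
    (hy : IsDesubstitution τ y ys δ) (i : ℕ) :
    wordAt (xs i) 1 (p - 1 - (δ i : ℕ)) ≠ wordAt (ys i) 1 (p - 1 - (δ i : ℕ)) ↔
      ∃ n ∈ Set.Ico (reach δ i) (reach δ (i + 1)), x n ≠ y n := by
  rw [← ((onWord_injective hinj).iterate i).ne_iff, hx.iterate_onWord_wordAt_one,
    hy.iterate_onWord_wordAt_one, ne_eq, wordAt_eq_iff, reach_succ, mul_comm]
  push Not
  constructor
  · rintro ⟨j, hj, hne⟩
    exact ⟨reach δ i + j, ⟨by omega, by omega⟩, by exact_mod_cast hne⟩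
  · rintro ⟨n, ⟨hin, hni⟩, hne⟩
    exact ⟨n - reach δ i, by omega, by rwa [← Nat.cast_add, Nat.add_sub_of_le hin]⟩

theorem frequently_wordAt_ne_iff (hinj : Function.Injective τ) (hx : IsDesubstitution τ x xs δ)
    (hy : IsDesubstitution τ y ys δ) (hδ : {i | (δ i : ℕ) ≠ p - 1}.Infinite) :
    (∃ᶠ i in atTop, wordAt (xs i) 1 (p - 1 - (δ i : ℕ)) ≠ wordAt (ys i) 1 (p - 1 - (δ i : ℕ))) ↔
      ∃ᶠ n : ℕ in atTop, x n ≠ y n := by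
  simp only [hx.wordAt_ne_iff hinj hy]
  exact frequently_exists_mem_Ico_iff (reach_mono δ) (tendsto_reach hδ)

end IsDesubstitution

end Fibre

/-! ### Proximal pairs -/

/-- Proximality of two sequences under `T`: they agree on arbitrarily long windows arbitrarily far
on the right. For the topology of `A^ℤ` this says `liminf ϱ(Tⁿx, Tⁿy) = 0`. -/
def IsProximal {A : Type*} (x y : ℤ → A) : Prop :=
  ∀ N : ℕ, ∃ᶠ n : ℕ in atTop, Set.EqOn (shiftBy n x) (shiftBy n y) (Set.Icc (-N) N)

section Proximal

variable {A : Type*} {p : ℕ} [NeZero p] {τ : A → Fin p → A}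

theorem exists_window_digit_eq [Finite A] (hrec : IsRecognizable τ) :
    ∃ N : ℕ, ∀ u ∈ subshift τ, ∀ v ∈ subshift τ, ∀ r s : Fin p,
      Set.EqOn (shiftBy (r : ℕ) (onSeq τ u)) (shiftBy (s : ℕ) (onSeq τ v)) (Set.Icc (-N) N) →
        r = s := by
  let : TopologicalSpace A := ⊥
  have : DiscreteTopology A := ⟨rfl⟩
  have hpair : ∀ q : Fin p × Fin p, ∃ N : ℕ, q.1 ≠ q.2 → ∀ u ∈ subshift τ, ∀ v ∈ subshift τ,
      ¬ Set.EqOn (shiftBy (q.1 : ℕ) (onSeq τ u)) (shiftBy (q.2 : ℕ) (onSeq τ v))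
        (Set.Icc (-N) N) := by
    rintro ⟨r, s⟩
    by_cases hrs : r = s
    · exact ⟨0, fun h => absurd hrs h⟩
    have hdisj : Disjoint ((fun u => shiftBy (r : ℕ) (onSeq τ u)) '' subshift τ)
        ((fun u => shiftBy (s : ℕ) (onSeq τ u)) '' subshift τ) := by
      rw [Set.disjoint_left]
      rintro _ ⟨u, hu, rfl⟩ ⟨v, hv, huv⟩
      have hmem := shiftBy_mem_subshift (onSeq_mem_subshift hu) (r : ℕ)
      exact hrs (Prod.mk.inj ((hrec _ hmem).unique (y₁ := (u, r)) (y₂ := (v, s)) ⟨hu, rfl⟩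
        ⟨hv, huv.symm⟩)).2
    obtain ⟨N, hN⟩ := exists_window_of_disjoint (isClosed_image_onSeq τ 1 _)
      (isClosed_image_onSeq τ 1 _) hdisj
    exact ⟨N, fun _ u hu v hv => hN _ ⟨u, hu, rfl⟩ _ ⟨v, hv, rfl⟩⟩
  choose N hN using hpair
  obtain ⟨M, hM⟩ := (Set.finite_range N).bddAbove
  refine ⟨M, fun u hu v hv r s h => by_contra fun hrs => hN (r, s) hrs u hu v hv (h.mono ?_)⟩
  have hNM : N (r, s) ≤ M := hM ⟨_, rfl⟩
  exact Set.Icc_subset_Icc (by omega) (by omega)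

theorem eqOn_of_eqOn_onSeq (hinj : Function.Injective τ) {u v : ℤ → A} {s : Fin p} {N : ℕ}
    (h : Set.EqOn (shiftBy (s : ℕ) (onSeq τ u)) (shiftBy (s : ℕ) (onSeq τ v))
      (Set.Icc (-(p * (N + 1) : ℕ)) (p * (N + 1) : ℕ))) : Set.EqOn u v (Set.Icc (-N) N) := by
  intro j ⟨hNj, hjN⟩
  have hp := natCast_pos_of_neZero (p := p)
  refine hinj (funext fun r => ?_)
  have hr := r.2
  have hs := s.2
  have hwindow : (p * j + (r : ℕ) - (s : ℕ) : ℤ) ∈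
      Set.Icc (-((p * (N + 1) : ℕ) : ℤ)) (p * (N + 1) : ℕ) := by
    have hlower := mul_le_mul_of_nonneg_left hNj hp.le
    have hupper := mul_le_mul_of_nonneg_left hjN hp.le
    push_cast
    constructor <;> linarith
  simpa only [shiftBy_apply, sub_add_cancel, onSeq_apply] using h hwindow

namespace IsDesubstitution

variable {x y : ℤ → A} {xs ys : ℕ → ℤ → A} {δ ε : ℕ → Fin p}

theorem tail (hx : IsDesubstitution τ x xs δ) :
    IsDesubstitution τ (xs 1) (fun i => xs (i + 1)) fun i => δ (i + 1) :=
  ⟨rfl, fun i => hx.2.1 (i + 1), fun i => hx.2.2 (i + 1)⟩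

theorem shiftBy_eq (hx : IsDesubstitution τ x xs δ) (n : ℕ) :
    shiftBy n x =
      shiftBy (addDigits δ n 0 : ℕ) (onSeq τ (shiftBy (carry δ n 1) (xs 1))) := by
  simpa only [carry_zero, hx.1] using (hx.shiftBy_addDigits n).eq_shiftBy_onSeq 0

theorem digit_zero_eq_of_isProximal [Finite A] (hrec : IsRecognizable τ)
    (hx : IsDesubstitution τ x xs δ) (hy : IsDesubstitution τ y ys ε) (h : IsProximal x y) :
    δ 0 = ε 0 := by
  obtain ⟨N, hN⟩ := exists_window_digit_eq hrec
  obtain ⟨n, hn⟩ := (h N).exists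
  rw [hx.shiftBy_eq n, hy.shiftBy_eq n] at hn
  have hdigit := hN _ (shiftBy_mem_subshift (hx.2.1 1) _) _ (shiftBy_mem_subshift (hy.2.1 1) _)
    _ _ hn
  rw [addDigits, addDigits, carry_zero, carry_zero] at hdigit
  have hmod : n + δ 0 ≡ n + ε 0 [MOD p] := Fin.val_eq_of_eq hdigit
  exact Fin.ext (hmod.add_left_cancel'.eq_of_lt_of_lt (δ 0).2 (ε 0).2)

theorem isProximal_tail (hinj : Function.Injective τ) (hx : IsDesubstitution τ x xs δ)
    (hy : IsDesubstitution τ y ys ε) (h : IsProximal x y) (h0 : δ 0 = ε 0) :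
    IsProximal (xs 1) (ys 1) := by
  intro N
  rw [frequently_atTop]
  intro M
  obtain ⟨n, hn, hwindow⟩ := frequently_atTop.1 (h (p * (N + 1))) (p * M)
  have hcarry : carry δ n 1 = carry ε n 1 := by
    rw [carry_succ, carry_succ, carry_zero, carry_zero, h0]
  have hdigit : addDigits δ n 0 = addDigits ε n 0 := by
    rw [addDigits, addDigits, carry_zero, carry_zero, h0]
  have hM : M ≤ carry δ n 1 := by
    rw [carry_succ, carry_zero, Nat.le_div_iff_mul_le (Nat.pos_of_neZero p)]
    linarith
  rw [hx.shiftBy_eq n, hy.shiftBy_eq n, ← hcarry, ← hdigit] at hwindow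
  exact ⟨_, hM, eqOn_of_eqOn_onSeq hinj hwindow⟩

theorem digit_eq_of_isProximal [Finite A] (hinj : Function.Injective τ)
    (hrec : IsRecognizable τ) (hx : IsDesubstitution τ x xs δ) (hy : IsDesubstitution τ y ys ε)
    (h : IsProximal x y) (i : ℕ) : δ i = ε i := by
  have h0 := hx.digit_zero_eq_of_isProximal hrec hy h
  induction i generalizing x y xs ys δ ε with
  | zero => exact h0
  | succ _ ih =>
    have htail := hx.isProximal_tail hinj hy h h0
    exact ih hx.tail hy.tail htail (hx.tail.digit_zero_eq_of_isProximal hrec hy.tail htail)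

theorem isProximal (hp : 2 ≤ p) {r : Fin p} (hcol : ∀ a b, τ a r = τ b r)
    (hx : IsDesubstitution τ x xs δ) (hy : IsDesubstitution τ y ys δ) : IsProximal x y := by
  intro N
  rw [frequently_atTop]
  intro M
  -- By the coincidence, the level `i` sequences agree at `t`, so `x` and `y` agree on a block of
  -- length `pⁱ`.
  set i := 2 * N + 1 + M
  have hpow : 2 * N + 1 + M < p ^ i := Nat.lt_pow_self hp
  have hoffset := reach_add_offset δ i
  obtain ⟨t, ht⟩ : ∃ t : ℤ, t + (δ i : ℕ) = p * 2 + (r : ℕ) := ⟨_, sub_add_cancel _ _⟩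
  have hlevel : xs i t = ys i t := by
    rw [hx.eq_shiftBy_onSeq i, hy.eq_shiftBy_onSeq i, shiftBy_apply, shiftBy_apply, ht,
      onSeq_apply, onSeq_apply]
    exact hcol _ _
  have ht2 : 2 ≤ t := by have := (δ i).2; omega
  have hpowt : (p : ℤ) ^ i * 2 ≤ p ^ i * t := by gcongr
  obtain ⟨n, hn⟩ : ∃ n : ℕ, (n : ℤ) = p ^ i * t - offset δ i + N := by
    refine ⟨(p ^ i * t - offset δ i + N : ℤ).toNat, Int.toNat_of_nonneg ?_⟩
    zify at hoffset
    omega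
  zify at hpow hoffset
  refine ⟨n, by omega, fun j ⟨hNj, hjN⟩ => ?_⟩
  have hblock : (j + n + offset δ i) / (p : ℤ) ^ i = t :=
    (Int.ediv_eq_iff_of_pos (by omega)).2 ⟨by linarith, by linarith⟩
  rw [shiftBy_apply, shiftBy_apply, hx.apply_eq_iterLetter i, hy.apply_eq_iterLetter i, hblock,
    hlevel]

end IsDesubstitution

end Proximal

/-! ### From metric to symbolic properties of pairs -/

section Metric

variable {X A : Type*} [MetricSpace X] [TopologicalSpace A] {T : X → X} {f : X → ℤ → A} {x y : X}

/-- A symbolic coding of the compact metric system `(X, T)`: an injective factor map `f` onto a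
subshift, by which topological properties of `T` are read off the sequences `f x`. -/
structure IsCoding (T : X → X) (f : X → ℤ → A) : Prop where
  compactSpace : CompactSpace X
  continuous : Continuous f
  injective : Function.Injective f
  map_apply : ∀ x, f (T x) = shiftBy 1 (f x)

theorem isBoundedUnder_le_dist [CompactSpace X] (u v : ℕ → X) :
    IsBoundedUnder (· ≤ ·) atTop fun n => dist (u n) (v n) :=
  isBoundedUnder_of ⟨_, fun n => Metric.dist_le_diam_of_mem isCompact_univ.isBounded
    (Set.mem_univ (u n)) (Set.mem_univ (v n))⟩

theorem isBoundedUnder_ge_dist (u v : ℕ → X) :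
    IsBoundedUnder (· ≥ ·) atTop fun n => dist (u n) (v n) :=
  isBoundedUnder_of ⟨0, fun _ => dist_nonneg⟩

theorem isLiYorkePair_iff_not_not [CompactSpace X] :
    IsLiYorkePair T x y ↔ ¬ IsDistalPair T x y ∧ ¬ IsAsymptoticPair T x y := by
  have hbdd := isBoundedUnder_le_dist (fun n => T^[n] x) fun n => T^[n] y
  have hbdd' := isBoundedUnder_ge_dist (fun n => T^[n] x) fun n => T^[n] y
  have hnonneg := le_liminf_of_le hbdd.isCoboundedUnder_ge (Eventually.of_forall fun n =>
    dist_nonneg (x := T^[n] x) (y := T^[n] y))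
  rw [IsDistalPair, hnonneg.lt_iff_ne', not_not, and_comm, IsLiYorkePair, IsAsymptoticPair]
  refine and_congr_left fun _ => ⟨fun hlimsup h => hlimsup.ne' h.limsup_eq, fun h => ?_⟩
  by_contra! hlimsup
  exact h (tendsto_of_le_liminf_of_limsup_le hnonneg hlimsup hbdd hbdd')

theorem isDistalPair_iff_forall_uniformity [CompactSpace X] :
    IsDistalPair T x y ↔ ¬ ∀ U ∈ uniformity X, ∃ᶠ n in atTop, (T^[n] x, T^[n] y) ∈ U := by
  have hbdd := (isBoundedUnder_le_dist (fun n => T^[n] x) fun n => T^[n] y).isCoboundedUnder_ge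
  have hbdd' := isBoundedUnder_ge_dist (fun n => T^[n] x) fun n => T^[n] y
  rw [IsDistalPair, ← not_le, liminf_le_iff hbdd hbdd', Metric.uniformity_basis_dist.forall_iff
    fun U V hUV hU => hU.mono fun n hn => hUV hn]
  rfl

namespace IsCoding

theorem map_iterate (hf : IsCoding T f) (n : ℕ) (x : X) : f (T^[n] x) = shiftBy n (f x) := by
  induction n with
  | zero => simp
  | succ n ih =>
    rw [Function.iterate_succ_apply', hf.map_apply, ih, shiftBy_shiftBy]
    push_cast
    rw [add_comm]

variable [DiscreteTopology A]

theorem hasBasis_uniformity (hf : IsCoding T f) :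
    (uniformity X).HasBasis (fun _ : ℕ => True)
      fun N => {q | Set.EqOn (f q.1) (f q.2) (Set.Icc (-N) N)} := by
  have := hf.compactSpace
  rw [← nhdsSet_diagonal_eq_uniformity]
  exact hasBasis_nhdsSet_diagonal hf.continuous hf.injective

theorem isDistalPair_iff (hf : IsCoding T f) : IsDistalPair T x y ↔ ¬ IsProximal (f x) (f y) := by
  have := hf.compactSpace
  rw [isDistalPair_iff_forall_uniformity, hf.hasBasis_uniformity.forall_iff
    fun U V hUV hU => hU.mono fun n hn => hUV hn]
  simp only [Set.mem_ofPred_eq, hf.map_iterate, forall_const, IsProximal]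

theorem isAsymptoticPair_iff (hf : IsCoding T f) :
    IsAsymptoticPair T x y ↔ ∀ᶠ n : ℕ in atTop, f x n = f y n := by
  rw [IsAsymptoticPair,
    ← tendsto_uniformity_iff_dist_tendsto_zero (f := fun n => (T^[n] x, T^[n] y)),
    hf.hasBasis_uniformity.tendsto_right_iff]
  simp only [Set.mem_ofPred_eq, hf.map_iterate, forall_const]
  constructor
  · intro h
    filter_upwards [h 0] with n hn
    simpa using hn (x := 0) (by simp)
  · intro h N
    obtain ⟨M, hM⟩ := eventually_atTop.1 h
    filter_upwards [eventually_ge_atTop (M + N)] with n hn j hj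
    obtain ⟨m, hm⟩ := Int.eq_ofNat_of_zero_le (a := j + n) (by have := hj.1; omega)
    rw [shiftBy_apply, shiftBy_apply, hm]
    exact hM m (by have := hj.1; omega)

theorem isLiYorkePair_iff (hf : IsCoding T f) :
    IsLiYorkePair T x y ↔ IsProximal (f x) (f y) ∧ ∃ᶠ n : ℕ in atTop, f x n ≠ f y n := by
  have := hf.compactSpace
  rw [isLiYorkePair_iff_not_not, hf.isDistalPair_iff, hf.isAsymptoticPair_iff, not_not,
    not_eventually]

end IsCoding

end Metric

theorem isCoding_subtypeVal {A : Type*} [Finite A] [TopologicalSpace A] [DiscreteTopology A]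
    {p : ℕ} (τ : A → Fin p → A) (ϱ : MetricSpace (subshift τ))
    (hϱ : ϱ.toPseudoMetricSpace.toUniformSpace.toTopologicalSpace =
      (instTopologicalSpaceSubtype : TopologicalSpace (subshift τ))) :
    IsCoding (shift τ) Subtype.val where
  compactSpace := by
    rw [hϱ]
    exact isCompact_iff_compactSpace.1 (isCompact_subshift τ)
  continuous := by
    rw [hϱ]
    exact continuous_subtype_val
  injective := Subtype.val_injective
  map_apply _ := rfl

/-! ### Points with prescribed digits -/

section Construction

variable {A : Type*} [Finite A] {p : ℕ} [NeZero p] {τ : A → Fin p → A}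

theorem exists_isDesubstitution_apply_zero (hinj : Function.Injective τ) (hprim : IsPrimitive τ)
    (hne : (subshift τ).Nonempty) {δ : ℕ → Fin p} {c : ℕ → A}
    (hc : ∀ i, τ (c (i + 1)) (δ i) = c i) :
    ∃ x xs, IsDesubstitution τ x xs δ ∧ ∀ i, xs i 0 = c i := by
  let : TopologicalSpace A := ⊥
  have : DiscreteTopology A := ⟨rfl⟩
  let F : ℕ → (ℤ → A) → ℤ → A := fun i u => shiftBy (offset δ i) ((onSeq τ)^[i] u)
  have hFsucc : ∀ i u, F (i + 1) u = F i (shiftBy (δ i : ℕ) (onSeq τ u)) := fun i u => by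
    simp only [F, iterate_onSeq_shiftBy, shiftBy_shiftBy, Function.iterate_succ_apply, offset_succ]
    push_cast
    rw [mul_comm]
  have hFinj : ∀ i, Function.Injective (F i) := fun i =>
    (shiftBy_injective _).comp ((onSeq_injective hinj).iterate i)
  have hcompact : ∀ i, IsCompact (F i '' (subshift τ ∩ {u | u 0 = c i})) := fun i =>
    ((isCompact_subshift τ).inter_right
      (isClosed_eq (continuous_apply 0) continuous_const)).image
      ((continuous_shiftBy _).comp ((continuous_onSeq τ).iterate i))
  have hanti : ∀ i, F (i + 1) '' (subshift τ ∩ {u | u 0 = c (i + 1)}) ⊆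
      F i '' (subshift τ ∩ {u | u 0 = c i}) := by
    rintro i _ ⟨u, ⟨hu, hu0 : u 0 = c (i + 1)⟩, rfl⟩
    refine ⟨_, ⟨shiftBy_mem_subshift (onSeq_mem_subshift hu) _, ?_⟩, (hFsucc i u).symm⟩
    simpa only [mul_zero, hu0, hc] using! onSeq_apply τ u 0 (δ i)
  have hnonempty : ∀ i, (F i '' (subshift τ ∩ {u | u 0 = c i})).Nonempty := fun i =>
    Set.Nonempty.image _ (exists_mem_subshift_apply_zero hprim hne (c i))
  obtain ⟨x, hx⟩ := IsCompact.nonempty_iInter_of_sequence_nonempty_isCompact_isClosed _ hanti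
    hnonempty (hcompact 0) fun i => (hcompact i).isClosed
  choose xs hxs hxF using Set.mem_iInter.1 hx
  refine ⟨x, xs, isDesubstitution_iff.2 ⟨?_, fun i => (hxs i).1, fun i => hFinj i ?_⟩,
    fun i => (hxs i).2⟩
  · simpa [F, offset] using hxF 0
  · rw [← hFsucc, hxF, hxF]

theorem exists_isDesubstitution_const_pair (hinj : Function.Injective τ) (hprim : IsPrimitive τ)
    (hX : (subshift τ).Nontrivial) {r : Fin p} (hr : Function.Injective fun a => τ a r) :
    ∃ x y xs ys, IsDesubstitution τ x xs (fun _ => r) ∧ IsDesubstitution τ y ys (fun _ => r) ∧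
      ∀ i, xs i 0 ≠ ys i 0 := by
  obtain ⟨u, hu, v, -, huv⟩ := hX
  obtain ⟨n, hn⟩ := Function.ne_iff.1 huv
  let σ : Equiv.Perm A := Equiv.ofBijective _ (Finite.injective_iff_bijective.1 hr)
  have hletters : ∀ a, ∃ x xs, IsDesubstitution τ x xs (fun _ => r) ∧
      ∀ i, xs i 0 = σ.symm^[i] a := fun a =>
    exists_isDesubstitution_apply_zero hinj hprim ⟨u, hu⟩ fun i => by
      rw [Function.iterate_succ_apply']
      exact σ.apply_symm_apply _
  obtain ⟨x, xs, hx, hx0⟩ := hletters (u n)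
  obtain ⟨y, ys, hy, hy0⟩ := hletters (v n)
  refine ⟨x, y, xs, ys, hx, hy, fun i => ?_⟩
  rw [hx0, hy0]
  exact (σ.symm.injective.iterate i).ne hn

theorem exists_isDesubstitution_frequently_ne (hinj : Function.Injective τ)
    (hprim : IsPrimitive τ) (hX : (subshift τ).Nontrivial) {r s : Fin p} (hrs : r < s)
    (hr : Function.Injective fun a => τ a r) (hs : Function.Injective fun a => τ a s) :
    ∃ x y xs ys δ, IsDesubstitution τ x xs δ ∧ IsDesubstitution τ y ys δ ∧
      ∃ᶠ n : ℕ in atTop, x n ≠ y n := by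
  obtain ⟨x, y, xs, ys, hx, hy, hne⟩ := exists_isDesubstitution_const_pair hinj hprim hX hr
  have hsp := s.2
  rw [Fin.lt_def] at hrs
  have hletter : ∀ {z zs}, IsDesubstitution τ z zs (fun _ => r) → ∀ i,
      zs i (1 + (s - r - 1 : ℕ)) = τ (zs (i + 1) 0) s := fun hz i => by
    rw [hz.eq_shiftBy_onSeq i, shiftBy_apply, ← onSeq_apply τ _ 0 s]
    congr 1
    omega
  refine ⟨x, y, xs, ys, _, hx, hy, (hx.frequently_wordAt_ne_iff hinj hy ?_).1 ?_⟩
  · exact Set.infinite_univ.mono fun _ _ => by rw [Set.mem_ofPred_eq]; omega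
  · refine Frequently.of_forall fun i heq => hne (i + 1) (hs ?_)
    have hword := wordAt_eq_iff.1 heq (s - r - 1) (by omega)
    rwa [hletter hx, hletter hy] at hword

theorem exists_isProximal_frequently_ne (hp : 2 ≤ p) (hinj : Function.Injective τ)
    (hprim : IsPrimitive τ) (hX : (subshift τ).Nontrivial) {r s t : Fin p}
    (ht : ∀ a b, τ a t = τ b t) (hrs : r ≠ s) (hr : Function.Injective fun a => τ a r)
    (hs : Function.Injective fun a => τ a s) :
    ∃ x ∈ subshift τ, ∃ y ∈ subshift τ, IsProximal x y ∧ ∃ᶠ n : ℕ in atTop, x n ≠ y n := by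
  wlog hlt : r < s generalizing r s
  · exact this hrs.symm hs hr (lt_of_le_of_ne (not_lt.1 hlt) hrs.symm)
  obtain ⟨x, y, xs, ys, δ, hx, hy, hne⟩ :=
    exists_isDesubstitution_frequently_ne hinj hprim hX hlt hr hs
  exact ⟨x, hx.mem_subshift, y, hy.mem_subshift, hx.isProximal hp ht hy, hne⟩

end Construction

/-! ### Fibres of the factor map -/

section OdometerFibre

theorem eventually_shiftBy_eq_iff {A : Type*} {x y : ℤ → A} (k : ℕ) :
    (∀ᶠ n : ℕ in atTop, shiftBy k x n = shiftBy k y n) ↔ ∀ᶠ n : ℕ in atTop, x n = y n := by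
  conv_rhs => rw [← map_add_atTop_eq_nat k, eventually_map]
  simp only [shiftBy_apply, Nat.cast_add]

theorem frequently_shiftBy_ne_iff {A : Type*} {x y : ℤ → A} (k : ℕ) :
    (∃ᶠ n : ℕ in atTop, shiftBy k x n ≠ shiftBy k y n) ↔ ∃ᶠ n : ℕ in atTop, x n ≠ y n := by
  rw [← not_eventually, ← not_eventually, eventually_shiftBy_eq_iff]

theorem IsProximal.frequently_eq {A : Type*} {x y : ℤ → A} (h : IsProximal x y) :
    ∃ᶠ n : ℕ in atTop, x n = y n :=
  (h 0).mono fun n hn => by simpa using hn (x := 0) (by simp)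

variable {A : Type*} [Nonempty A] {p : ℕ} [NeZero p] {τ : A → Fin p → A} {x y : ℤ → A}

theorem toOdometer_shiftBy_congr (hrec : IsRecognizable τ) (hx : x ∈ subshift τ)
    (hy : y ∈ subshift τ) (hxy : toOdometer τ x = toOdometer τ y) (k : ℕ) :
    toOdometer τ (shiftBy k x) = toOdometer τ (shiftBy k y) := by
  rw [toOdometer_shiftBy hrec hx, toOdometer_shiftBy hrec hy, hxy]

theorem toOdometer_eq_of_isProximal [Finite A] (hinj : Function.Injective τ)
    (hrec : IsRecognizable τ) (hx : x ∈ subshift τ) (hy : y ∈ subshift τ) (h : IsProximal x y) :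
    toOdometer τ x = toOdometer τ y :=
  funext ((isDesubstitution_level hrec hx).digit_eq_of_isProximal hinj hrec
    (isDesubstitution_level hrec hy) h)

theorem isDesubstitution_level_of_toOdometer_eq (hrec : IsRecognizable τ)
    (hy : y ∈ subshift τ) (hxy : toOdometer τ x = toOdometer τ y) :
    IsDesubstitution τ y (level τ y) (toOdometer τ x) :=
  hxy ▸ isDesubstitution_level hrec hy

theorem apply_eq_iff_of_infinite_iPlus (hcol : ∀ r, Function.Injective fun a => τ a r)
    (hrec : IsRecognizable τ) (hx : x ∈ subshift τ) (hy : y ∈ subshift τ)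
    (hxy : toOdometer τ x = toOdometer τ y) {k : ℕ} (hI : (iPlus τ (shiftBy k x)).Infinite)
    {n : ℕ} (hkn : k ≤ n) : x n = y n ↔ x k = y k := by
  have hkx := shiftBy_mem_subshift hx k
  have hky := shiftBy_mem_subshift hy k
  obtain ⟨m, rfl⟩ := Nat.exists_eq_add_of_le' hkn
  have := (isDesubstitution_level hrec hkx).apply_eq_iff_apply_zero_eq hcol
    (isDesubstitution_level_of_toOdometer_eq hrec hky (toOdometer_shiftBy_congr hrec hx hy hxy k))
    (iPlus_eq (τ := τ) _ ▸ hI) m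
  simpa only [shiftBy_apply, zero_add, Nat.cast_add] using this

theorem not_isProximal_of_apply_ne (hcol : ∀ r, Function.Injective fun a => τ a r)
    (hrec : IsRecognizable τ) (hx : x ∈ subshift τ) (hy : y ∈ subshift τ)
    (hxy : toOdometer τ x = toOdometer τ y) {k : ℕ} (hI : (iPlus τ (shiftBy k x)).Infinite)
    (hne : x k ≠ y k) : ¬ IsProximal x y := fun h => by
  obtain ⟨n, hkn, hn⟩ := frequently_atTop.1 h.frequently_eq k
  exact hne ((apply_eq_iff_of_infinite_iPlus hcol hrec hx hy hxy hI hkn).1 hn)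

theorem eventually_eq_of_forall_apply_eq (hp : 2 ≤ p)
    (hcol : ∀ r, Function.Injective fun a => τ a r) (hrec : IsRecognizable τ)
    (hx : x ∈ subshift τ) (hy : y ∈ subshift τ) (hxy : toOdometer τ x = toOdometer τ y)
    (h : ∀ k : ℕ, (iPlus τ (shiftBy k x)).Infinite → x k = y k) :
    ∀ᶠ n : ℕ in atTop, x n = y n := by
  obtain ⟨k, hI⟩ := exists_infinite_iPlus_shiftBy hp hrec hx
  filter_upwards [eventually_ge_atTop k] with n hkn
  exact (apply_eq_iff_of_infinite_iPlus hcol hrec hx hy hxy hI hkn).2 (h k hI)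

theorem eventually_eq_of_toOdometer_eq (hp : 2 ≤ p) {r₀ : Fin p}
    (hcol : ∀ r ≠ r₀, ∀ a b, τ a r = τ b r) (hrec : IsRecognizable τ) (hx : x ∈ subshift τ)
    (hy : y ∈ subshift τ) (hxy : toOdometer τ x = toOdometer τ y) :
    ∀ᶠ n : ℕ in atTop, x n = y n := by
  obtain ⟨k, hI⟩ := exists_infinite_iPlus_shiftBy hp hrec hx
  rw [← eventually_shiftBy_eq_iff k]
  exact (isDesubstitution_level hrec (shiftBy_mem_subshift hx k)).eventually_eq hcol
    (isDesubstitution_level_of_toOdometer_eq hrec (shiftBy_mem_subshift hy k)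
      (toOdometer_shiftBy_congr hrec hx hy hxy k)) (iPlus_eq (τ := τ) _ ▸ hI)

theorem isProximal_of_toOdometer_eq (hp : 2 ≤ p) {r : Fin p} (hcol : ∀ a b, τ a r = τ b r)
    (hrec : IsRecognizable τ) (hx : x ∈ subshift τ) (hy : y ∈ subshift τ)
    (hxy : toOdometer τ x = toOdometer τ y) : IsProximal x y :=
  (isDesubstitution_level hrec hx).isProximal hp hcol
    (isDesubstitution_level_of_toOdometer_eq hrec hy hxy)

theorem infinite_sWord_ne_iff (hinj : Function.Injective τ) (hrec : IsRecognizable τ)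
    (hx : x ∈ subshift τ) (hy : y ∈ subshift τ) (hxy : toOdometer τ x = toOdometer τ y)
    (hI : (iPlus τ x).Infinite) :
    {i | sWord τ x i ≠ sWord τ y i}.Infinite ↔ ∃ᶠ n : ℕ in atTop, x n ≠ y n := by
  rw [iPlus_eq] at hI
  rw [← Nat.frequently_atTop_iff_infinite]
  simpa only [sWord, ← hxy] using (isDesubstitution_level hrec hx).frequently_wordAt_ne_iff hinj
    (isDesubstitution_level_of_toOdometer_eq hrec hy hxy) hI

theorem frequently_ne_iff_infinite_sWord_ne (hp : 2 ≤ p) (hinj : Function.Injective τ)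
    (hrec : IsRecognizable τ) (hx : x ∈ subshift τ) (hy : y ∈ subshift τ)
    (hxy : toOdometer τ x = toOdometer τ y) :
    (∃ᶠ n : ℕ in atTop, x n ≠ y n) ↔
      ((iPlus τ x).Infinite ∧ {i | sWord τ x i ≠ sWord τ y i}.Infinite) ∨
      ((iPlus τ x).Finite ∧ {i | sWord τ (shiftBy (kPlus τ x) x) i ≠
        sWord τ (shiftBy (kPlus τ y) y) i}.Infinite) := by
  by_cases hI : (iPlus τ x).Finite
  · rw [or_iff_right fun h => h.1 hI, and_iff_right hI, ← kPlus_congr hxy,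
      infinite_sWord_ne_iff hinj hrec (shiftBy_mem_subshift hx _) (shiftBy_mem_subshift hy _)
        (toOdometer_shiftBy_congr hrec hx hy hxy _)
        (infinite_iPlus_shiftBy_kPlus hp hrec hx hI), frequently_shiftBy_ne_iff]
  · rw [or_iff_left fun h => hI h.1, and_iff_right (Set.not_finite.1 hI),
      infinite_sWord_ne_iff hinj hrec hx hy hxy (Set.not_finite.1 hI)]

end OdometerFibre

/-! ### Coincidences -/

section Coincidence

variable {A : Type*} {p : ℕ} {τ : A → Fin p → A}

theorem not_hasCoincidence_iff :
    ¬ HasCoincidence τ ↔ ∀ r, Function.Injective fun a => τ a r :=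
  ⟨fun h r a b hab => by_contra fun hne => h ⟨a, b, hne, r, hab⟩,
    fun h ⟨_, _, hne, r, hab⟩ => hne (h r hab)⟩

theorem HasCoincidence.exists_column_const
    (hcol : ∀ r, (Function.Injective fun a => τ a r) ∨ ∀ a b, τ a r = τ b r)
    (h : HasCoincidence τ) : ∃ r, ∀ a b, τ a r = τ b r := by
  obtain ⟨a, b, hab, r, hr⟩ := h
  exact ⟨r, (hcol r).resolve_left fun hinj => hab (hinj hr)⟩

theorem exists_injective_columns_or_eventually_const [NeZero p]
    (hcol : ∀ r, (Function.Injective fun a => τ a r) ∨ ∀ a b, τ a r = τ b r) :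
    (∃ r s, r ≠ s ∧ (Function.Injective fun a => τ a r) ∧ Function.Injective fun a => τ a s) ∨
      ∃ r₀, ∀ r ≠ r₀, ∀ a b, τ a r = τ b r := by
  by_cases h : ∃ r₀, Function.Injective fun a => τ a r₀
  · obtain ⟨r₀, hr₀⟩ := h
    by_contra! hcon
    obtain ⟨r, hr, a, b, hab⟩ := hcon.2 r₀
    exact hcon.1 r r₀ hr ((hcol r).resolve_right fun h => hab (h a b)) hr₀
  · exact Or.inr ⟨0, fun r _ => (hcol r).resolve_left fun hr => h ⟨r, hr⟩⟩

theorem hasCoincidence_and_injective_columns_of_isProximal [Finite A] [Nonempty A] [NeZero p]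
    (hp : 2 ≤ p) (hinj : Function.Injective τ) (hrec : IsRecognizable τ)
    (hcol : ∀ r, (Function.Injective fun a => τ a r) ∨ ∀ a b, τ a r = τ b r) {x y : ℤ → A}
    (hx : x ∈ subshift τ) (hy : y ∈ subshift τ) (h : IsProximal x y)
    (hne : ∃ᶠ n : ℕ in atTop, x n ≠ y n) :
    HasCoincidence τ ∧ ∃ r s, r ≠ s ∧ (Function.Injective fun a => τ a r) ∧
      Function.Injective fun a => τ a s := by
  have hxy := toOdometer_eq_of_isProximal hinj hrec hx hy h
  replace hne := not_eventually.2 hne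
  refine ⟨by_contra fun hno => ?_,
    (exists_injective_columns_or_eventually_const hcol).resolve_right ?_⟩
  · rw [not_hasCoincidence_iff] at hno
    exact hne (eventually_eq_of_forall_apply_eq hp hno hrec hx hy hxy fun k hI =>
      by_contra fun hk => not_isProximal_of_apply_ne hno hrec hx hy hxy hI hk h)
  · rintro ⟨r₀, hr₀⟩
    exact hne (eventually_eq_of_toOdometer_eq hp hr₀ hrec hx hy hxy)

theorem injective_fin_two_iff {B : Type*} (g : Fin 2 → B) : Function.Injective g ↔ g 0 ≠ g 1 := by
  simp [Function.Injective, Fin.forall_fin_two, eq_comm]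

theorem injective_or_const_of_fin_two {B : Type*} (g : Fin 2 → B) :
    Function.Injective g ∨ ∀ a b, g a = g b := by
  rw [injective_fin_two_iff, or_iff_not_imp_left, not_not]
  simp +contextual [Fin.forall_fin_two]

end Coincidence

end ConstLengthSubst

theorem corollary3p12_general {A : Type*} [Finite A] [Nonempty A] [TopologicalSpace A]
    [DiscreteTopology A] {p : ℕ} [NeZero p] (hp : 2 ≤ p) {τ : A → Fin p → A}
    (hinj : Function.Injective τ) (hprim : IsPrimitive τ) (hinf : (subshift τ).Infinite)
    (hcol : ∀ r, (Function.Injective fun a => τ a r) ∨ ∀ a b, τ a r = τ b r)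
    (ϱ : MetricSpace (subshift τ))
    (hϱ : ϱ.toPseudoMetricSpace.toUniformSpace.toTopologicalSpace =
      (instTopologicalSpaceSubtype : TopologicalSpace (subshift τ))) :
    (¬ HasCoincidence τ →
      ∀ x y : subshift τ, toOdometer τ x = toOdometer τ y →
        ((∃ i : ℕ, x.1 i ≠ y.1 i ∧
            (iPlus τ ((shift τ)^[i] x)).Infinite ∧ (iPlus τ ((shift τ)^[i] y)).Infinite) →
          IsDistalPair (shift τ) x y) ∧
        ((¬ ∃ i : ℕ, x.1 i ≠ y.1 i ∧
            (iPlus τ ((shift τ)^[i] x)).Infinite ∧ (iPlus τ ((shift τ)^[i] y)).Infinite) →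
          IsAsymptoticPair (shift τ) x y)) ∧
    ((∃! r, Function.Injective fun a => τ a r) →
      ∀ x y : subshift τ, toOdometer τ x = toOdometer τ y →
        IsAsymptoticPair (shift τ) x y) ∧
    ((∃ x y : subshift τ, IsLiYorkePair (shift τ) x y) ↔
      HasCoincidence τ ∧ ∃ r s, r ≠ s ∧ (Function.Injective fun a => τ a r) ∧
        Function.Injective fun a => τ a s) ∧
    (HasCoincidence τ →
      ∀ x y : subshift τ, toOdometer τ x = toOdometer τ y →
        (IsLiYorkePair (shift τ) x y ↔
          ((iPlus τ x).Infinite ∧ {i : ℕ | sWord τ x i ≠ sWord τ y i}.Infinite) ∨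
          ((iPlus τ x).Finite ∧
            {i : ℕ | sWord τ ((shift τ)^[kPlus τ x] x) i ≠
              sWord τ ((shift τ)^[kPlus τ y] y) i}.Infinite))) := by
  have hrec := isRecognizable_of_infinite hinj hprim hinf
  have hval := isCoding_subtypeVal τ ϱ hϱ
  simp only [hval.isDistalPair_iff, hval.isAsymptoticPair_iff, hval.isLiYorkePair_iff,
    hval.map_iterate]
  refine ⟨fun hno x y hxy => ⟨?_, fun h => ?_⟩, fun ⟨r₀, _, huniq⟩ x y hxy => ?_,
    ⟨?_, ?_⟩, fun hcoin x y hxy => ?_⟩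
  · rintro ⟨k, hk, hI, -⟩
    exact not_isProximal_of_apply_ne (not_hasCoincidence_iff.1 hno) hrec x.2 y.2 hxy hI hk
  · refine eventually_eq_of_forall_apply_eq hp (not_hasCoincidence_iff.1 hno) hrec x.2 y.2 hxy
      fun k hI => by_contra fun hk => h ⟨k, hk, hI, ?_⟩
    rwa [← iPlus_congr (toOdometer_shiftBy_congr hrec x.2 y.2 hxy k)]
  · exact eventually_eq_of_toOdometer_eq hp
      (fun r hr => (hcol r).resolve_left fun h => hr (huniq r h)) hrec x.2 y.2 hxy
  · rintro ⟨x, y, hprox, hne⟩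
    exact hasCoincidence_and_injective_columns_of_isProximal hp hinj hrec hcol x.2 y.2 hprox hne
  · rintro ⟨hcoin, r, s, hrs, hr, hs⟩
    obtain ⟨t, ht⟩ := hcoin.exists_column_const hcol
    obtain ⟨x, hx, y, hy, h⟩ :=
      exists_isProximal_frequently_ne hp hinj hprim hinf.nontrivial ht hrs hr hs
    exact ⟨⟨x, hx⟩, ⟨y, hy⟩, h⟩
  · obtain ⟨r, hr⟩ := hcoin.exists_column_const hcol
    rw [and_iff_right (isProximal_of_toOdometer_eq hp hr hrec x.2 y.2 hxy)]
    exact frequently_ne_iff_infinite_sWord_ne hp hinj hrec x.2 y.2 hxy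

theorem corollary3p12 (p : ℕ) [NeZero p] (hp : 2 ≤ p)
    (τ : Fin 2 → Fin p → Fin 2)
    (hinj : Function.Injective τ)
    (hprim : IsPrimitive τ)
    (hinf : (subshift τ).Infinite)
    -- `ϱ` is any metric on `X_τ` that induces the topology of `X_τ` (as a subspace of `{0,1}^ℤ`)
    (ϱ : MetricSpace (subshift τ))
    (hϱ : ϱ.toPseudoMetricSpace.toUniformSpace.toTopologicalSpace =
      (instTopologicalSpaceSubtype : TopologicalSpace (subshift τ))) :
    -- (1) no coincidence
    (¬ HasCoincidence τ →
      ∀ x y : subshift τ, toOdometer τ x = toOdometer τ y →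
        ((∃ i : ℕ, x.1 i ≠ y.1 i ∧
            (iPlus τ ((shift τ)^[i] x)).Infinite ∧ (iPlus τ ((shift τ)^[i] y)).Infinite) →
          IsDistalPair (shift τ) x y) ∧
        ((¬ ∃ i : ℕ, x.1 i ≠ y.1 i ∧
            (iPlus τ ((shift τ)^[i] x)).Infinite ∧ (iPlus τ ((shift τ)^[i] y)).Infinite) →
          IsAsymptoticPair (shift τ) x y)) ∧
    -- (2) a unique non-coincidence
    ((∃! i : Fin p, τ 0 i ≠ τ 1 i) →
      ∀ x y : subshift τ, toOdometer τ x = toOdometer τ y →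
        IsAsymptoticPair (shift τ) x y) ∧
    -- (3) existence of Li–Yorke pairs
    ((∃ x y : subshift τ, IsLiYorkePair (shift τ) x y) ↔
      HasCoincidence τ ∧ ∃ i j : Fin p, i ≠ j ∧ τ 0 i ≠ τ 1 i ∧ τ 0 j ≠ τ 1 j) ∧
    -- (3) description of the Li–Yorke pairs in a fibre
    (HasCoincidence τ →
      ∀ x y : subshift τ, toOdometer τ x = toOdometer τ y →
        (IsLiYorkePair (shift τ) x y ↔
          ((iPlus τ x).Infinite ∧ {i : ℕ | sWord τ x i ≠ sWord τ y i}.Infinite) ∨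
          ((iPlus τ x).Finite ∧
            {i : ℕ | sWord τ ((shift τ)^[kPlus τ x] x) i ≠
              sWord τ ((shift τ)^[kPlus τ y] y) i}.Infinite))) := by
  simpa only [injective_fin_two_iff] using corollary3p12_general hp hinj hprim hinf
    (fun r => injective_or_const_of_fin_two fun a => τ a r) ϱ hϱ
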